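/- Let $d, r$ be non-negative integers. For an invertible real $d\times d$ matrix $C$ and $f \in L^2(\mathbb{R}^d)$ (complex valued), put $T_a f = f(\cdot - a)$ for $a\in\mathbb{R}^d$, $D_C f = |\det C|^{1/2} f(C\,\cdot)$, and $\widetilde D_C f = |\det C|\, f(C\,\cdot)$. The Fourier transform on $L^2(\mathbb{R}^d)$ is normalized by $\hat f(\xi) = \int f(x) e^{-2\pi i x\cdot \xi}\,dx$ for $f\in L^1\cap L^2$, and $C^*$ denotes the transpose of $C$. A matrix is expansive if all its eigenvalues have modulus strictly greater than $1$ (in particular it is invertible). For $\Psi = (\psi_1,\dots,\psi_r)$ in $L^2(\mathbb{R}^d)$, the quasi-affine system $\mathcal{U}^q_C(\Psi)$ is the family $(u_{n,z,i})$ indexed by $n\in\mathbb{Z}$, $z\in\mathbb{Z}^d$, $1\le i\le r$, where $u_{n,z,i} = D_C^n T_z\psi_i$ if $n\ge 0$ and $u_{n,z,i} = T_z \widetilde D_C^{\,n}\psi_i$ if $n<0$. A family $(x_j)_{j\in J}$ in a Hilbert space $H$ is Bessel if there is a constant $M<\infty$ with $\sum_j |\langle v,x_j\rangle|^2 \le M\|v\|^2$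 for all $v\in H$; two Bessel families $(x_j)_{j\in J}$, $(y_j)_{j\in J}$ with the same index set are orthogonal if $\sum_j \langle v,x_j\rangle y_j = 0$ for all $v\in H$ (the sum converging unconditionally). Theorem. Let $A$ be an expansive $d\times d$ matrix with integer entries and let $B$ be any expansive real $d\times d$ matrix with $A\ne B$. Let $\Psi=(\psi_1,\dots,\psi_r)$ and $\Phi=(\phi_1,\dots,\phi_r)$ be in $L^2(\mathbb{R}^d)$, and suppose that $\mathcal{U}^q_A(\Psi)$ and $\mathcal{U}^q_B(\Phi)$ are Bessel. Then for all $k\in\mathbb{Z}^d$ and $1\le i\le r$ the series $\sum_{j>0} \overline{\hat\psi_i(A^{*j}\xi)}\,\hat\phi_i(B^{*j}(\xi+k))$ converges absolutely for a.e. $\xi$, and $\mathcal{U}^q_A(\Psi)$ and $\mathcal{U}^q_B(\Phi)$ are orthogonal if and only if both of the following hold: (1) for every $k\in\mathbb{Z}^d$, $\sum_{i=1}^r \overline{\hat\psi_i(\xi)}\,\hat\phi_i(\xi+k) = 0$ for a.e. $\xi\in\mathbb{R}^d$; (2) for every $k\in\mathbb{Z}^d$, $\sum_{i=1}^r\sum_{j>0}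 \overline{\hat\psi_i(A^{*j}\xi)}\,\hat\phi_i(B^{*j}(\xi+k)) = 0$ for a.e. $\xi\in\mathbb{R}^d$. -/

import Mathlib

open MeasureTheory
open scoped FourierTransform MatrixGroups

noncomputable section

namespace QuasiAffine

/-- Euclidean space `ℝ^d`. -/
abbrev Eu (d : ℕ) : Type := EuclideanSpace ℝ (Fin d)

/-- The Hilbert space `L²(ℝ^d)` of complex valued functions, with Lebesgue measure. -/
abbrev L2 (d : ℕ) : Type := Lp (α := Eu d) ℂ 2 (volume : Measure (Eu d))

/-- The point of `ℝ^d` with the integer coordinates `k`. -/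
def intPt {d : ℕ} (k : Fin d → ℤ) : Eu d := WithLp.toLp 2 (fun i => (k i : ℝ))

/-- A matrix is expansive if all its (complex) eigenvalues have modulus greater than `1`. -/
def IsExpansive {d : ℕ} (A : Matrix (Fin d) (Fin d) ℝ) : Prop :=
  ∀ μ : ℂ, Module.End.HasEigenvalue (Matrix.toLin' (A.map (algebraMap ℝ ℂ))) μ → 1 < ‖μ‖

/-- A matrix is integral if all its entries are integers. -/
def IsIntegralMatrix {d : ℕ} (A : Matrix (Fin d) (Fin d) ℝ) : Prop :=
  ∀ i j, ∃ n : ℤ, A i j = n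

/-! ### Bessel families and orthogonality in a Hilbert space -/

section Hilbert

variable {H : Type*} [NormedAddCommGroup H] [InnerProductSpace ℂ H] {J : Type*}

/-- The family `x` is Bessel: `∑ |⟨v, x j⟩|² ≤ C ‖v‖²` for all `v`. -/
def IsBessel (x : J → H) : Prop :=
  ∃ C : ℝ, ∀ v : H, Summable (fun j => ‖inner ℂ (x j) v‖ ^ 2) ∧
    ∑' j, ‖inner ℂ (x j) v‖ ^ 2 ≤ C * ‖v‖ ^ 2

/-- The families `x` and `y` are orthogonal: `∑ ⟨v, x j⟩ y j = 0` for all `v`.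
(Mathlib's inner product is linear in its second argument.) -/
def AreOrthogonal (x y : J → H) : Prop :=
  ∀ v : H, HasSum (fun j => inner ℂ (x j) v • y j) 0

end Hilbert

/-! ### Translations and dilations on `L²(ℝ^d)` -/

variable {d : ℕ}

/-- The translation `T_a f = f(· - a)`. -/
def translation (a : Eu d) (f : L2 d) : L2 d :=
  Lp.compMeasurePreserving (fun x : Eu d => x - a) (measurePreserving_sub_right volume a) f

theorem det_toEuclideanLin_ne_zero (A : GL (Fin d) ℝ) :
    LinearMap.det (Matrix.toEuclideanLin (A : Matrix (Fin d) (Fin d) ℝ)) ≠ 0 := by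
  rw [LinearMap.det_toLpLin]
  exact A.det.ne_zero

theorem memLp_comp (A : GL (Fin d) ℝ) (f : L2 d) :
    MemLp (fun x : Eu d => f (Matrix.toEuclideanLin (A : Matrix (Fin d) (Fin d) ℝ) x)) 2
      volume := by
  have hmap := Measure.map_linearMap_addHaar_eq_smul_addHaar (volume : Measure (Eu d))
    (det_toEuclideanLin_ne_zero A)
  have hm : AEMeasurable (Matrix.toEuclideanLin (A : Matrix (Fin d) (Fin d) ℝ)) volume :=
    (LinearMap.continuous_of_finiteDimensional _).aemeasurable
  have h : MemLp f 2 (Measure.map (Matrix.toEuclideanLin (A : Matrix (Fin d) (Fin d) ℝ))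
      volume) := by
    rw [hmap]
    exact (Lp.memLp f).smul_measure ENNReal.ofReal_ne_top
  exact (memLp_map_measure_iff h.1 hm).1 h

/-- The composition `f(A ·)` of `f ∈ L²(ℝ^d)` with an invertible matrix. -/
def compMat (A : GL (Fin d) ℝ) (f : L2 d) : L2 d := (memLp_comp A f).toLp _

theorem compMat_ae (A : GL (Fin d) ℝ) (f : L2 d) :
    ∀ᵐ x, compMat A f x = f (Matrix.toEuclideanLin (A : Matrix (Fin d) (Fin d) ℝ) x) :=
  (memLp_comp A f).coeFn_toLp

theorem quasiMP (A : GL (Fin d) ℝ) :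
    Measure.QuasiMeasurePreserving
      (Matrix.toEuclideanLin (A : Matrix (Fin d) (Fin d) ℝ)) volume volume := by
  refine ⟨(LinearMap.continuous_of_finiteDimensional _).measurable, ?_⟩
  rw [Measure.map_linearMap_addHaar_eq_smul_addHaar _ (det_toEuclideanLin_ne_zero A)]
  exact Measure.smul_absolutelyContinuous

theorem compMat_compMat (A B : GL (Fin d) ℝ) (h : A * B = 1) (f : L2 d) :
    compMat B (compMat A f) = f := by
  apply Lp.ext
  filter_upwards [compMat_ae B (compMat A f), (quasiMP B).ae (compMat_ae A f)] with x h1 h2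
  rw [h1, h2]
  congr 1
  have : (A : Matrix (Fin d) (Fin d) ℝ) * (B : Matrix (Fin d) (Fin d) ℝ) = 1 := by
    rw [← Units.val_mul, h, Units.val_one]
  have h3 := Matrix.toLpLin_mul_same (p := 2) (A : Matrix (Fin d) (Fin d) ℝ)
    (B : Matrix (Fin d) (Fin d) ℝ)
  rw [this, Matrix.toLpLin_one] at h3
  exact (congrArg (fun g => g x) h3).symm

/-- `f ↦ f(A ·)` as a linear automorphism of `L²(ℝ^d)`. -/
def compMatEquiv (A : GL (Fin d) ℝ) : L2 d ≃ₗ[ℂ] L2 d where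
  toFun := compMat A
  invFun := compMat A⁻¹
  map_add' f g := by
    apply Lp.ext
    filter_upwards [compMat_ae A (f + g), compMat_ae A f, compMat_ae A g,
      Lp.coeFn_add (compMat A f) (compMat A g), (quasiMP A).ae (Lp.coeFn_add f g)]
      with x h1 h2 h3 h4 h5
    rw [h1, h4, h5, Pi.add_apply, Pi.add_apply, h2, h3]
  map_smul' c f := by
    apply Lp.ext
    filter_upwards [compMat_ae A (c • f), compMat_ae A f,
      Lp.coeFn_smul c (compMat A f), (quasiMP A).ae (Lp.coeFn_smul c f)]
      with x h1 h2 h4 h5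
    rw [h1, RingHom.id_apply, h4, h5, Pi.smul_apply, Pi.smul_apply, h2]
  left_inv f := compMat_compMat A A⁻¹ (mul_inv_cancel A) f
  right_inv f := compMat_compMat A⁻¹ A (inv_mul_cancel A) f

theorem absDet_ne_zero (A : GL (Fin d) ℝ) :
    ((|(A : Matrix (Fin d) (Fin d) ℝ).det| : ℝ) : ℂ) ≠ 0 := by
  simpa using A.det.ne_zero

theorem sqrtAbsDet_ne_zero (A : GL (Fin d) ℝ) :
    ((√|(A : Matrix (Fin d) (Fin d) ℝ).det| : ℝ) : ℂ) ≠ 0 := by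
  have : (A : Matrix (Fin d) (Fin d) ℝ).det ≠ 0 := A.det.ne_zero
  simpa [Real.sqrt_eq_zero'] using this

/-- The dilation `D_A f = |det A|^{1/2} f(A ·)`. -/
def dilation (A : GL (Fin d) ℝ) : L2 d ≃ₗ[ℂ] L2 d :=
  (compMatEquiv A).trans (LinearEquiv.smulOfNeZero ℂ (L2 d) _ (sqrtAbsDet_ne_zero A))

/-- The renormalized dilation `f ↦ |det A| f(A ·)`. -/
def renormDilation (A : GL (Fin d) ℝ) : L2 d ≃ₗ[ℂ] L2 d :=
  (compMatEquiv A).trans (LinearEquiv.smulOfNeZero ℂ (L2 d) _ (absDet_ne_zero A))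

/-- The quasi-affine system generated by `ψ 0, …, ψ (r - 1)` and the matrix `A`, indexed by
`(n, z, i) ∈ ℤ × ℤ^d × {0, …, r - 1}`: the member is `D_A^n T_z ψ_i` for `n ≥ 0`, and
`T_z D̃_A^n ψ_i` for `n < 0`, where `D̃_A` is the renormalized dilation. The powers are those
of the group of linear automorphisms of `L²(ℝ^d)`. -/
def quasiAffine (A : GL (Fin d) ℝ) {r : ℕ} (ψ : Fin r → L2 d) :
    ℤ × (Fin d → ℤ) × Fin r → L2 d :=
  fun p =>
    if 0 ≤ p.1 then (dilation A ^ p.1) (translation (intPt p.2.1) (ψ p.2.2))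
    else translation (intPt p.2.1) ((renormDilation A ^ p.1) (ψ p.2.2))

/-- The point `(A^*)^j x`, where `A^*` is the transpose of `A`. -/
def adjPow (A : GL (Fin d) ℝ) (j : ℕ) (x : Eu d) : Eu d :=
  Matrix.toEuclideanLin ((A : Matrix (Fin d) (Fin d) ℝ).transpose ^ j) x

end QuasiAffine

end

open QuasiAffine

/-! For Bessel systems the mixed operator `v ↦ ∑ ⟨v, x_j⟩ y_j` is a sum of level operators S_n, one
for each scale n. Let R be the sum over n ≥ 0 and Q the sum over n < 0; orthogonality means R + Q =
0. Two symmetries of these operators conflict. Every S_n with n ≤ 0 commutes with integer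
translations, so Q does, and hence so does R = -Q. On the other hand S_{n+1} D_A = D_B S_n for n ≥
0, so R D_A = S_0 D_A + D_B R. Take integer vectors a and b = Aa with Aa ≠ Ba, and put c = B⁻¹b ≠ a.
Since D_A T_b = T_a D_A and D_B T_b = T_c D_B, computing R D_A T_b v in two ways gives T_a D_B R v =
T_c D_B R v. No nonzero function in L² has a period, so R = 0, and then Q = 0 and S_0 = 0.
Conversely S_0 = 0 kills every S_n with n ≥ 0. This is `areOrthogonal_quasiAffine_iff_levelOp`. Both
S_0 = 0 and Q = 0 say that two systems of integer translates are orthogonal. By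
`areOrthogonal_shiftSystem_iff` (Plancherel, and Parseval on the unit cube) this means that all
correlations `∑ conj F̂_γ(ξ) Ĝ_γ(ξ + k)` vanish. For S_0 these are the sums in (1). For Q they are
the sums in (2), because D̃_A^{-j} acts on Fourier transforms as composition with A^{*j}. -/

noncomputable section

namespace QuasiAffine

/-! ### Bessel families and their mixed operators -/

section Hilbert

variable {H : Type*} [NormedAddCommGroup H] [InnerProductSpace ℂ H] {I J : Type*}

theorem IsBessel.exists_nonneg {x : J → H} (hx : IsBessel x) :
    ∃ C : ℝ, 0 ≤ C ∧ ∀ v : H, Summable (fun j => ‖inner ℂ (x j) v‖ ^ 2) ∧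
      ∑' j, ‖inner ℂ (x j) v‖ ^ 2 ≤ C * ‖v‖ ^ 2 := by
  obtain ⟨C, hC⟩ := hx
  exact ⟨max C 0, le_max_right _ _, fun v => ⟨(hC v).1, (hC v).2.trans
    (mul_le_mul_of_nonneg_right (le_max_left _ _) (by positivity))⟩⟩

theorem IsBessel.comp_injective {x : J → H} (hx : IsBessel x) {e : I → J}
    (he : Function.Injective e) : IsBessel (x ∘ e) := by
  obtain ⟨C, hC⟩ := hx
  refine ⟨C, fun v => ⟨(hC v).1.comp_injective he, le_trans ?_ (hC v).2⟩⟩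
  exact tsum_comp_le_tsum_of_inj (hC v).1 (fun _ => by positivity) he

/-- Expanding ⟨u, u⟩ for the sum u and applying Cauchy–Schwarz with the Bessel bound gives ‖u‖⁴ ≤ (∑
|c_j|²) C ‖u‖²; one factor ‖u‖² cancels. -/
theorem norm_sum_smul_sq_le {y : J → H} {C : ℝ} (hC0 : 0 ≤ C)
    (hC : ∀ v : H, Summable (fun j => ‖inner ℂ (y j) v‖ ^ 2) ∧
      ∑' j, ‖inner ℂ (y j) v‖ ^ 2 ≤ C * ‖v‖ ^ 2) (c : J → ℂ) (s : Finset J) :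
    ‖∑ j ∈ s, c j • y j‖ ^ 2 ≤ C * ∑ j ∈ s, ‖c j‖ ^ 2 := by
  set u := ∑ j ∈ s, c j • y j with hu
  have h1 : ‖u‖ ^ 2 ≤ ∑ j ∈ s, ‖c j‖ * ‖inner ℂ (y j) u‖ := by
    have h : inner ℂ u u = ∑ j ∈ s, c j * inner ℂ u (y j) := by
      conv_lhs => rw [hu]
      rw [inner_sum]
      simp only [inner_smul_right, ← hu]
    have h' : ‖u‖ ^ 2 = ‖inner ℂ u u‖ := by
      rw [inner_self_eq_norm_sq_to_K]; simp
    rw [h', h]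
    refine (norm_sum_le _ _).trans (le_of_eq ?_)
    simp only [norm_mul, norm_inner_symm u]
  have h2 : (∑ j ∈ s, ‖c j‖ * ‖inner ℂ (y j) u‖) ^ 2 ≤
      (∑ j ∈ s, ‖c j‖ ^ 2) * (C * ‖u‖ ^ 2) := by
    refine (Finset.sum_mul_sq_le_sq_mul_sq _ _ _).trans ?_
    refine mul_le_mul_of_nonneg_left ?_ (by positivity)
    exact ((hC u).1.sum_le_tsum s (fun _ _ => by positivity)).trans (hC u).2
  have h3 : (‖u‖ ^ 2) ^ 2 ≤ (∑ j ∈ s, ‖c j‖ ^ 2) * (C * ‖u‖ ^ 2) :=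
    (pow_le_pow_left₀ (by positivity) h1 2).trans h2
  rcases eq_or_lt_of_le (sq_nonneg ‖u‖) with h0 | h0
  · rw [← h0]
    positivity
  · refine le_of_mul_le_mul_right (h3.trans_eq' ?_ |>.trans_eq ?_) h0 <;> ring

theorem IsBessel.summable_smul [CompleteSpace H] {y : J → H} (hy : IsBessel y) {c : J → ℂ}
    (hc : Summable fun j => ‖c j‖ ^ 2) : Summable fun j => c j • y j := by
  obtain ⟨C, hC0, hC⟩ := hy.exists_nonneg
  rw [summable_iff_vanishing_norm]
  intro ε hε
  -- The denominator is C + 1 because C may be zero.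
  have hδ : 0 < ε ^ 2 / (C + 1) := by positivity
  obtain ⟨s, hs⟩ := summable_iff_vanishing_norm.1 hc _ hδ
  refine ⟨s, fun t ht => ?_⟩
  have h1 := norm_sum_smul_sq_le hC0 hC c t
  have h2 := (le_abs_self _).trans_lt (hs t ht)
  have h3 : (0 : ℝ) ≤ ∑ j ∈ t, ‖c j‖ ^ 2 := by positivity
  rw [lt_div_iff₀ (by positivity)] at h2
  exact lt_of_pow_lt_pow_left₀ 2 hε.le (by nlinarith)

theorem IsBessel.summable_mixed [CompleteSpace H] {x y : J → H} (hx : IsBessel x)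
    (hy : IsBessel y) (v : H) : Summable fun j => inner ℂ (x j) v • y j := by
  obtain ⟨C, hC⟩ := hx
  exact hy.summable_smul (hC v).1

theorem areOrthogonal_iff_tsum [CompleteSpace H] {x y : J → H} (hx : IsBessel x)
    (hy : IsBessel y) :
    AreOrthogonal x y ↔ ∀ v : H, ∑' j, inner ℂ (x j) v • y j = 0 :=
  forall_congr' fun v => (hx.summable_mixed hy v).hasSum_iff

theorem IsBessel.hasSum_inner_mixed [CompleteSpace H] {x y : J → H} (hx : IsBessel x)
    (hy : IsBessel y) (v w : H) :
    HasSum (fun j => inner ℂ (x j) v * inner ℂ w (y j))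
      (inner ℂ w (∑' j, inner ℂ (x j) v • y j)) := by
  have := (hx.summable_mixed hy v).hasSum.mapL (innerSL ℂ w)
  simpa [inner_smul_right] using this

/-- Orthogonality of Bessel families may be tested on a set whose orthogonal complement is
trivial. -/
theorem areOrthogonal_iff_of_total [CompleteSpace H] {x y : J → H} (hx : IsBessel x)
    (hy : IsBessel y) {D : Set H} (hD : ∀ u : H, (∀ v ∈ D, inner ℂ v u = 0) → u = 0) :
    AreOrthogonal x y ↔ ∀ v ∈ D, ∀ w ∈ D,
      ∑' j, inner ℂ (x j) v * inner ℂ w (y j) = 0 := by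
  rw [areOrthogonal_iff_tsum hx hy]
  constructor
  · intro h v _ w _
    rw [(hx.hasSum_inner_mixed hy v w).tsum_eq, h v, inner_zero_right]
  · intro h
    -- The mixed operator with x and y exchanged is the adjoint. It vanishes on D first; this then
    -- frees the vector v from D.
    have h1 : ∀ w ∈ D, ∑' j, inner ℂ (y j) w • x j = 0 := by
      intro w hw
      refine hD _ fun v hv => ?_
      rw [← (hy.hasSum_inner_mixed hx w v).tsum_eq, ← map_zero (starRingEnd ℂ), ← h v hv w hw,
        Complex.conj_tsum]
      refine tsum_congr fun j => ?_
      rw [map_mul, inner_conj_symm, inner_conj_symm, mul_comm]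
    intro v
    refine hD _ fun w hw => ?_
    rw [← (hx.hasSum_inner_mixed hy v w).tsum_eq, ← map_zero (starRingEnd ℂ),
      ← inner_zero_right v, ← h1 w hw, ← (hy.hasSum_inner_mixed hx w v).tsum_eq,
        Complex.conj_tsum]
    refine tsum_congr fun j => ?_
    rw [map_mul, inner_conj_symm, inner_conj_symm, mul_comm]

end Hilbert

/-! ### The Fourier transform of translations and dilations -/

section

variable {d : ℕ}

theorem translation_ae (a : Eu d) (f : L2 d) :
    ∀ᵐ x, translation a f x = f (x - a) :=
  Lp.coeFn_compMeasurePreserving f (measurePreserving_sub_right volume a)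

/-- Translation as a linear isometry. -/
def translationIsometry (a : Eu d) : L2 d →ₗᵢ[ℂ] L2 d :=
  Lp.compMeasurePreservingₗᵢ ℂ (fun x : Eu d => x - a) (measurePreserving_sub_right volume a)

theorem translationIsometry_apply (a : Eu d) (f : L2 d) :
    translationIsometry a f = translation a f := rfl

theorem norm_compMat (A : GL (Fin d) ℝ) (f : L2 d) :
    ‖compMat A f‖ = (√|(A : Matrix (Fin d) (Fin d) ℝ).det|)⁻¹ * ‖f‖ := by
  have hmap := Measure.map_linearMap_addHaar_eq_smul_addHaar (volume : Measure (Eu d))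
    (det_toEuclideanLin_ne_zero A)
  have hm : AEMeasurable (Matrix.toEuclideanLin (A : Matrix (Fin d) (Fin d) ℝ)) volume :=
    (LinearMap.continuous_of_finiteDimensional _).aemeasurable
  have hf : AEStronglyMeasurable f (Measure.map (Matrix.toEuclideanLin
      (A : Matrix (Fin d) (Fin d) ℝ)) volume) := by
    rw [hmap]
    exact (Lp.aestronglyMeasurable f).mono_ac Measure.smul_absolutelyContinuous
  have h := eLpNorm_map_measure (p := 2) hf hm
  rw [hmap, eLpNorm_smul_measure_of_ne_top (by norm_num)] at h
  rw [Lp.norm_def, Lp.norm_def, eLpNorm_congr_ae (compMat_ae A f)]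
  have h' : (fun x => f (Matrix.toEuclideanLin (A : Matrix (Fin d) (Fin d) ℝ) x)) =
    f ∘ Matrix.toEuclideanLin (A : Matrix (Fin d) (Fin d) ℝ) := rfl
  rw [h', ← h, smul_eq_mul, ENNReal.toReal_mul]
  congr 1
  rw [LinearMap.det_toLpLin, ← ENNReal.toReal_rpow, ENNReal.toReal_ofReal (abs_nonneg _),
    abs_inv, Real.inv_rpow (abs_nonneg _), Real.sqrt_eq_rpow]
  norm_num

theorem continuous_compMat (A : GL (Fin d) ℝ) : Continuous (compMat A : L2 d → L2 d) :=
  ((compMatEquiv A).toLinearMap.mkContinuous _ fun f => (norm_compMat A f).le).continuous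

theorem norm_dilation (A : GL (Fin d) ℝ) (f : L2 d) : ‖dilation A f‖ = ‖f‖ := by
  have h : (0 : ℝ) < √|(A : Matrix (Fin d) (Fin d) ℝ).det| :=
    Real.sqrt_pos.2 (abs_pos.2 A.det.ne_zero)
  change ‖((√|(A : Matrix (Fin d) (Fin d) ℝ).det| : ℝ) : ℂ) • compMat A f‖ = _
  rw [norm_smul, norm_compMat, Complex.norm_real, Real.norm_of_nonneg h.le,
    mul_inv_cancel_left₀ h.ne']

/-- The dilation as a unitary operator. -/
def dilationIsometry (A : GL (Fin d) ℝ) : L2 d ≃ₗᵢ[ℂ] L2 d where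
  toLinearEquiv := dilation A
  norm_map' := norm_dilation A

/-- The character `ξ ↦ e^{-2πi⟨a, ξ⟩}`. -/
def char (a ξ : Eu d) : ℂ := (Real.fourierChar (-inner ℝ a ξ) : ℂ)

theorem continuous_char (a : Eu d) : Continuous (char a) := by
  unfold char
  exact continuous_subtype_val.comp (Real.continuous_fourierChar.comp (by fun_prop))

theorem norm_char (a ξ : Eu d) : ‖char a ξ‖ = 1 := Circle.norm_coe _

theorem memLp_modulation (a : Eu d) (f : L2 d) :
    MemLp (fun ξ => char a ξ * f ξ) 2 volume := by
  refine (Lp.memLp f).of_le_mul (c := 1)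
    ((continuous_char a).aestronglyMeasurable.mul (Lp.aestronglyMeasurable f)) ?_
  filter_upwards with ξ
  rw [norm_mul, norm_char]

/-- Multiplication with a character. -/
def modulation (a : Eu d) : L2 d →L[ℂ] L2 d :=
  LinearMap.mkContinuous
    { toFun := fun f => (memLp_modulation a f).toLp _
      map_add' := fun f g => by
        apply Lp.ext
        filter_upwards [(memLp_modulation a (f + g)).coeFn_toLp, (memLp_modulation a f).coeFn_toLp,
          (memLp_modulation a g).coeFn_toLp, Lp.coeFn_add f g,
          Lp.coeFn_add ((memLp_modulation a f).toLp _) ((memLp_modulation a g).toLp _)]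
          with ξ h1 h2 h3 h4 h5
        rw [h1, h5, Pi.add_apply, h2, h3, h4, Pi.add_apply, mul_add]
      map_smul' := fun c f => by
        apply Lp.ext
        filter_upwards [(memLp_modulation a (c • f)).coeFn_toLp,
          (memLp_modulation a f).coeFn_toLp, Lp.coeFn_smul c f,
          Lp.coeFn_smul c ((memLp_modulation a f).toLp _)] with ξ h1 h2 h4 h5
        rw [h1, RingHom.id_apply, h5, Pi.smul_apply, h2, h4, Pi.smul_apply, smul_eq_mul,
          smul_eq_mul, mul_left_comm] } 1 fun f => by
    refine Lp.norm_le_mul_norm_of_ae_le_mul ?_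
    filter_upwards [(memLp_modulation a f).coeFn_toLp] with ξ h1
    change ‖((memLp_modulation a f).toLp _ : L2 d) ξ‖ ≤ _
    rw [h1, norm_mul, norm_char]

theorem modulation_ae (a : Eu d) (f : L2 d) :
    ∀ᵐ ξ, modulation a f ξ = char a ξ * f ξ :=
  (memLp_modulation a f).coeFn_toLp

theorem schwartz_toLp_ae (g : SchwartzMap (Eu d) ℂ) :
    ∀ᵐ x, (g.toLp 2 : L2 d) x = g x :=
  g.coeFn_toLp 2 volume

open SchwartzMap in
-- Both sides are continuous in f, so Schwartz functions suffice; there the Fourier integral is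
-- available and translation is a change of variables.
theorem fourier_translation (a : Eu d) (f : L2 d) :
    𝓕 (translation a f) = modulation a (𝓕 f) := by
  refine DenseRange.induction_on (p := fun f : L2 d => 𝓕 (translation a f) = modulation a (𝓕 f))
    (SchwartzMap.denseRange_toLpCLM (E := Eu d) (F := ℂ) (p := 2)
      (μ := volume) (by simp)) f ?_ ?_
  · refine isClosed_eq ?_ ?_
    · exact (Lp.fourierTransformₗᵢ (Eu d) ℂ).continuous.comp (translationIsometry a).continuous
    · exact (modulation a).continuous.comp (Lp.fourierTransformₗᵢ (Eu d) ℂ).continuous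
  · intro g
    have h1 : translation a (g.toLp 2 : L2 d) = (g.compSubConstCLM ℂ a).toLp 2 := by
      apply Lp.ext
      filter_upwards [translation_ae a (g.toLp 2 : L2 d), (g.compSubConstCLM ℂ a).coeFn_toLp 2,
        (measurePreserving_sub_right volume a).quasiMeasurePreserving.ae (schwartz_toLp_ae g)]
        with x h1 h2 h3
      rw [h1, h2, h3, compSubConstCLM_apply]
    change 𝓕 (translation a (g.toLp 2 : L2 d)) = modulation a (𝓕 (g.toLp 2 : L2 d))
    rw [h1, SchwartzMap.toLp_fourier_eq, SchwartzMap.toLp_fourier_eq]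
    apply Lp.ext
    filter_upwards [(𝓕 (g.compSubConstCLM ℂ a)).coeFn_toLp 2,
      modulation_ae a ((𝓕 g).toLp 2 : L2 d),
      (𝓕 g).coeFn_toLp 2] with ξ h1 h2 h3
    rw [h1, h2, h3, SchwartzMap.fourier_coe, SchwartzMap.fourier_coe]
    have := congrFun (VectorFourier.fourierIntegral_comp_add_right Real.fourierChar volume
      (innerₗ (Eu d)) g (-a)) ξ
    simp only [innerₗ_apply_apply, inner_neg_left] at this
    simpa [char, ← sub_eq_add_neg, Circle.smul_def, Real.fourier_eq,
      VectorFourier.fourierIntegral] using this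

theorem integral_comp_toEuclideanLin (A : GL (Fin d) ℝ) (h : Eu d → ℂ) :
    ∫ x, h (Matrix.toEuclideanLin (A : Matrix (Fin d) (Fin d) ℝ) x) =
      ((|(A : Matrix (Fin d) (Fin d) ℝ).det| : ℝ) : ℂ)⁻¹ * ∫ x, h x := by
  have hmap := Measure.map_linearMap_addHaar_eq_smul_addHaar (volume : Measure (Eu d))
    (det_toEuclideanLin_ne_zero A)
  let e := (LinearEquiv.ofIsUnitDet (f := Matrix.toEuclideanLin (A : Matrix (Fin d) (Fin d) ℝ))
    (v := (EuclideanSpace.basisFun (Fin d) ℝ).toBasis)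
    (v' := (EuclideanSpace.basisFun (Fin d) ℝ).toBasis)
    (by
      rw [LinearMap.det_toMatrix]
      exact (det_toEuclideanLin_ne_zero A).isUnit)).toContinuousLinearEquiv
  have he : MeasurableEmbedding (Matrix.toEuclideanLin (A : Matrix (Fin d) (Fin d) ℝ)) :=
    e.toHomeomorph.measurableEmbedding
  rw [← he.integral_map, hmap, integral_smul_measure, LinearMap.det_toLpLin,
    ENNReal.toReal_ofReal (abs_nonneg _), abs_inv, ← Complex.ofReal_inv, Complex.real_smul]

theorem toEuclideanLin_apply_apply_of_mul_eq_one {M N : Matrix (Fin d) (Fin d) ℝ} (h : M * N = 1)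
    (x : Eu d) : Matrix.toEuclideanLin M (Matrix.toEuclideanLin N x) = x := by
  have h3 := Matrix.toLpLin_mul_same (p := 2) M N
  rw [h, Matrix.toLpLin_one] at h3
  exact (congrArg (fun g => g x) h3).symm

theorem inner_toEuclideanLin_left (M : Matrix (Fin d) (Fin d) ℝ) (x y : Eu d) :
    inner ℝ (Matrix.toEuclideanLin M x) y = inner ℝ x (Matrix.toEuclideanLin M.transpose y) := by
  have := LinearMap.adjoint_inner_right (Matrix.toEuclideanLin M) x y
  rw [← this, ← Matrix.toEuclideanLin_conjTranspose_eq_adjoint,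
    Matrix.conjTranspose_eq_transpose_of_trivial]

theorem smul_compMat_schwartz_ae (D : GL (Fin d) ℝ) (c : ℂ) (g : SchwartzMap (Eu d) ℂ) :
    ∀ᵐ ξ, (c • compMat D (g.toLp 2 : L2 d)) ξ =
      c * g (Matrix.toEuclideanLin (D : Matrix (Fin d) (Fin d) ℝ) ξ) := by
  filter_upwards [compMat_ae D (g.toLp 2 : L2 d), (quasiMP D).ae (schwartz_toLp_ae g),
    Lp.coeFn_smul c (compMat D (g.toLp 2 : L2 d))] with ξ h2 h3 h4
  rw [h4, Pi.smul_apply, h2, h3, smul_eq_mul]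

open SchwartzMap in
-- Here D is the inverse transpose of A, so that ⟨Ax, Dξ⟩ = ⟨x, ξ⟩. By density the claim is the
-- substitution y = Ax in the Fourier integral of a Schwartz function.
theorem fourier_compMat (A D : GL (Fin d) ℝ)
    (h : (D : Matrix (Fin d) (Fin d) ℝ).transpose * (A : Matrix (Fin d) (Fin d) ℝ) = 1) (f : L2 d) :
    𝓕 (compMat A f) =
      ((|(A : Matrix (Fin d) (Fin d) ℝ).det| : ℝ) : ℂ)⁻¹ • compMat D (𝓕 f) := by
  refine DenseRange.induction_on (p := fun f : L2 d => 𝓕 (compMat A f) =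
      ((|(A : Matrix (Fin d) (Fin d) ℝ).det| : ℝ) : ℂ)⁻¹ • compMat D (𝓕 f))
    (SchwartzMap.denseRange_toLpCLM (E := Eu d) (F := ℂ) (p := 2)
      (μ := volume) (by simp)) f ?_ ?_
  · refine isClosed_eq ?_ ?_
    · exact (Lp.fourierTransformₗᵢ (Eu d) ℂ).continuous.comp (continuous_compMat A)
    · exact (continuous_const_smul (T := L2 d) _).comp
        ((continuous_compMat D).comp (Lp.fourierTransformₗᵢ (Eu d) ℂ).continuous)
  · intro g
    let e := (LinearEquiv.ofIsUnitDet (f := Matrix.toEuclideanLin (A : Matrix (Fin d) (Fin d) ℝ))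
      (v := (EuclideanSpace.basisFun (Fin d) ℝ).toBasis)
      (v' := (EuclideanSpace.basisFun (Fin d) ℝ).toBasis)
      (by
        rw [LinearMap.det_toMatrix]
        exact (det_toEuclideanLin_ne_zero A).isUnit)).toContinuousLinearEquiv
    have he : ∀ x, e x = Matrix.toEuclideanLin (A : Matrix (Fin d) (Fin d) ℝ) x := fun _ => rfl
    have h1 : compMat A (g.toLp 2 : L2 d) = (compCLMOfContinuousLinearEquiv ℂ e g).toLp 2 := by
      apply Lp.ext
      filter_upwards [compMat_ae A (g.toLp 2 : L2 d),
        (compCLMOfContinuousLinearEquiv ℂ e g).coeFn_toLp 2,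
        (quasiMP A).ae (schwartz_toLp_ae g)] with x h1 h2 h3
      rw [h1, h2, h3, compCLMOfContinuousLinearEquiv_apply, Function.comp_apply, he]
    change 𝓕 (compMat A (g.toLp 2 : L2 d)) = _ • compMat D (𝓕 (g.toLp 2 : L2 d))
    rw [h1, SchwartzMap.toLp_fourier_eq, SchwartzMap.toLp_fourier_eq]
    apply Lp.ext
    filter_upwards [schwartz_toLp_ae (𝓕 (compCLMOfContinuousLinearEquiv ℂ e g)),
      smul_compMat_schwartz_ae D ((|(A : Matrix (Fin d) (Fin d) ℝ).det| : ℝ) : ℂ)⁻¹ (𝓕 g)]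
      with ξ h1 h2
    rw [h1, h2, SchwartzMap.fourier_coe, SchwartzMap.fourier_coe,
      Real.fourier_eq, Real.fourier_eq, ← integral_comp_toEuclideanLin A]
    refine integral_congr_ae (.of_forall fun x => ?_)
    simp only [compCLMOfContinuousLinearEquiv_apply, Function.comp_apply, he]
    rw [inner_toEuclideanLin_left, toEuclideanLin_apply_apply_of_mul_eq_one]
    simpa using congrArg Matrix.transpose h

end

/-! ### Unit cubes and Fourier series -/

section

variable {d : ℕ}

/-- The half-open cube `m + (0, 1]^d`. -/
def cube (m : Fin d → ℤ) : Set (Eu d) := {x | ∀ i, x i ∈ Set.Ioc (m i : ℝ) (m i + 1)}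

theorem measurableSet_cube (m : Fin d → ℤ) : MeasurableSet (cube m) := by
  have : cube m = ⋂ i, (fun x : Eu d => x i) ⁻¹' Set.Ioc (m i : ℝ) (m i + 1) := by
    ext x; simp [cube]
  rw [this]
  refine MeasurableSet.iInter fun i => ?_
  exact (EuclideanSpace.proj (𝕜 := ℝ) i).continuous.measurable measurableSet_Ioc

theorem exists_mem_cube (x : Eu d) : ∃ m, x ∈ cube m := by
  -- The intervals are open on the left and closed on the right, hence the ceiling minus one.
  refine ⟨fun i => ⌈x i⌉ - 1, fun i => ?_⟩
  push_cast
  constructor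
  · linarith [Int.ceil_lt_add_one (x i)]
  · linarith [Int.le_ceil (x i)]

theorem add_intPt_mem_cube_iff (m : Fin d → ℤ) (x : Eu d) :
    x + intPt m ∈ cube m ↔ x ∈ cube (0 : Fin d → ℤ) := by
  refine forall_congr' fun i => ?_
  simp only [PiLp.add_apply, intPt, Set.mem_Ioc, Pi.zero_apply, Int.cast_zero]
  constructor <;> rintro ⟨h1, h2⟩ <;> constructor <;> linarith

theorem measurePreserving_add_intPt (m : Fin d → ℤ) :
    MeasurePreserving (fun x : Eu d => x + intPt m) (volume.restrict (cube 0))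
      (volume.restrict (cube m)) := by
  have h := (measurePreserving_add_right (volume : Measure (Eu d)) (intPt m)).restrict_preimage
    (measurableSet_cube m)
  have h' : (fun x : Eu d => x + intPt m) ⁻¹' cube m = cube 0 := by
    ext x; exact add_intPt_mem_cube_iff m x
  rwa [h'] at h

theorem setIntegral_cube_eq (m : Fin d → ℤ) (f : Eu d → ℂ) :
    ∫ x in cube m, f x = ∫ x in cube 0, f (x + intPt m) := by
  refine ((measurePreserving_add_intPt m).integral_comp ?_ f).symm
  exact (Homeomorph.addRight (intPt m)).measurableEmbedding

theorem volume_cube_lt_top (m : Fin d → ℤ) : volume (cube m) < ⊤ := by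
  have hc : IsCompact ((EuclideanSpace.equiv (Fin d) ℝ) ⁻¹'
      Set.Icc (fun i => (m i : ℝ)) (fun i => (m i : ℝ) + 1)) :=
    (EuclideanSpace.equiv (Fin d) ℝ).toHomeomorph.isCompact_preimage.2 isCompact_Icc
  refine lt_of_le_of_lt (measure_mono ?_) hc.measure_lt_top
  exact fun x hx => ⟨fun i => (hx i).1.le, fun i => (hx i).2⟩

section Torus

-- Haar measure of total mass one on the circle, which makes the torus match the unit cube with
-- Lebesgue measure.
local instance : MeasureSpace UnitAddCircle := ⟨AddCircle.haarAddCircle⟩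

local instance : Measure.IsAddHaarMeasure (volume : Measure UnitAddCircle) :=
  inferInstanceAs (Measure.IsAddHaarMeasure AddCircle.haarAddCircle)

local instance : IsProbabilityMeasure (volume : Measure UnitAddCircle) :=
  inferInstanceAs (IsProbabilityMeasure AddCircle.haarAddCircle)

/-- The section of the quotient map `ℝ^d → ℝ^d/ℤ^d` with values in the unit cube. -/
def torusSection (t : UnitAddTorus (Fin d)) : Eu d :=
  WithLp.toLp 2 (UnitAddTorus.measurableEquivPiIoc (0 : Fin d → ℝ) t).1

theorem measurePreserving_torusSection :
    MeasurePreserving (torusSection (d := d)) volume (volume.restrict (cube 0)) := by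
  have hs : MeasurableSet {x : Fin d → ℝ | ∀ i, x i ∈ Set.Ioc ((0 : Fin d → ℝ) i)
      ((0 : Fin d → ℝ) i + 1)} :=
    MeasurableSet.univ_pi' fun _ => measurableSet_Ioc
  have h1 := UnitAddTorus.measurePreserving_equivPiIoc (0 : Fin d → ℝ)
  have h2 := measurePreserving_subtype_coe (μa := (volume : Measure (Fin d → ℝ))) hs
  have h3 := (PiLp.volume_preserving_toLp (Fin d)).restrict_preimage (measurableSet_cube 0)
  have h5 : (WithLp.toLp 2 : (Fin d → ℝ) → Eu d) ⁻¹' cube 0 = {x : Fin d → ℝ |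
      ∀ i, x i ∈ Set.Ioc ((0 : Fin d → ℝ) i) ((0 : Fin d → ℝ) i + 1)} := by
    ext x
    simp [cube]
  rw [h5] at h3
  exact h3.comp (h2.comp h1)

theorem mFourier_eq_char (z : Fin d → ℤ) (t : UnitAddTorus (Fin d)) :
    UnitAddTorus.mFourier (-z) t = char (intPt z) (torusSection t) := by
  have ht : ∀ i, t i = ((torusSection t i : ℝ) : UnitAddCircle) := fun i =>
    congrFun ((UnitAddTorus.measurableEquivPiIoc (0 : Fin d → ℝ)).symm_apply_apply t).symm i
  set x := torusSection t
  rw [UnitAddTorus.mFourier, ContinuousMap.coe_mk, char, Real.fourierChar_apply]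
  simp_rw [ht, fourier_coe_apply]
  rw [← Complex.exp_sum]
  congr 1
  simp only [PiLp.inner_apply, intPt, Pi.neg_apply, RCLike.inner_apply, conj_trivial]
  push_cast
  rw [← Finset.sum_neg_distrib, Finset.mul_sum, Finset.sum_mul]
  refine Finset.sum_congr rfl fun i _ => ?_
  ring

theorem integral_comp_torusSection {h : Eu d → ℂ}
    (hh : AEStronglyMeasurable h (volume.restrict (cube 0))) :
    ∫ t, h (torusSection t) = ∫ ξ in cube 0, h ξ := by
  have hs := measurePreserving_torusSection (d := d)
  rw [← hs.map_eq] at hh ⊢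
  exact (integral_map hs.aemeasurable hh).symm

/-- Parseval's identity on the torus, carried to the cube by the measure preserving `torusSection`.
-/
theorem hasSum_fourier_cube {a b : Eu d → ℂ} (ha : MemLp a 2 (volume.restrict (cube 0)))
    (hb : MemLp b 2 (volume.restrict (cube 0))) :
    HasSum (fun z : Fin d → ℤ =>
      (starRingEnd ℂ) (∫ ξ in cube 0, char (intPt z) ξ * a ξ) *
        ∫ ξ in cube 0, char (intPt z) ξ * b ξ)
      (∫ ξ in cube 0, (starRingEnd ℂ) (a ξ) * b ξ) := by
  have hs := measurePreserving_torusSection (d := d)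
  have ha' := ha.comp_measurePreserving hs
  have hb' := hb.comp_measurePreserving hs
  have hcoeff : ∀ {c : Eu d → ℂ} (hc : MemLp c 2 (volume.restrict (cube 0)))
      (z : Fin d → ℤ), UnitAddTorus.mFourierCoeff ((hc.comp_measurePreserving hs).toLp) z =
        ∫ ξ in cube 0, char (intPt z) ξ * c ξ := by
    intro c hc z
    rw [← integral_comp_torusSection (h := fun ξ => char (intPt z) ξ * c ξ)
      ((continuous_char _).aestronglyMeasurable.mul hc.1),
      UnitAddTorus.mFourierCoeff]
    refine integral_congr_ae ?_
    filter_upwards [(hc.comp_measurePreserving hs).coeFn_toLp] with t ht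
    rw [ht, mFourier_eq_char, smul_eq_mul, Function.comp_apply]
  have := UnitAddTorus.hasSum_prod_mFourierCoeff ha'.toLp hb'.toLp
  simp_rw [← hcoeff ha, ← hcoeff hb]
  convert this using 1
  rw [← integral_comp_torusSection (h := fun ξ => (starRingEnd ℂ) (a ξ) * b ξ)
    ((Complex.continuous_conj.comp_aestronglyMeasurable ha.1).mul hb.1)]
  refine integral_congr_ae ?_
  filter_upwards [ha'.coeFn_toLp, hb'.coeFn_toLp] with t h1 h2
  rw [h1, h2, Function.comp_apply, Function.comp_apply]

end Torus

end

/-! ### Integer translates against band-limited functions -/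

section

variable {d : ℕ}

theorem intPt_add (m k : Fin d → ℤ) : intPt (m + k) = intPt m + intPt k := by
  ext i; simp [intPt]

theorem char_intPt_add_intPt (z m : Fin d → ℤ) (ξ : Eu d) :
    char (intPt z) (ξ + intPt m) = char (intPt z) ξ := by
  have h : inner ℝ (intPt z) (intPt m) = ((∑ i, m i * z i : ℤ) : ℝ) := by
    simp [PiLp.inner_apply, intPt]
  rw [char, char, inner_add_right, neg_add, AddChar.map_add_eq_mul, h, Circle.coe_mul]
  have : (Real.fourierChar (-((∑ i, m i * z i : ℤ) : ℝ)) : ℂ) = 1 := by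
    rw [Real.fourierChar_apply, Complex.exp_eq_one_iff]
    refine ⟨-∑ i, m i * z i, ?_⟩
    push_cast
    ring
  rw [this, mul_one]

theorem ae_restrict_cube_iff (m : Fin d → ℤ) (p : Eu d → Prop) :
    (∀ᵐ ξ ∂(volume.restrict (cube 0)), p (ξ + intPt m)) ↔
      ∀ᵐ ξ ∂(volume.restrict (cube m)), p ξ := by
  rw [← (measurePreserving_add_intPt m).map_eq]
  exact ((Homeomorph.addRight (intPt m)).measurableEmbedding.ae_map_iff).symm

theorem ae_of_forall_ae_restrict_cube {p : Eu d → Prop}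
    (h : ∀ m, ∀ᵐ ξ ∂(volume.restrict (cube m)), p ξ) : ∀ᵐ ξ, p ξ := by
  have : ∀ᵐ ξ, ∀ m, ξ ∈ cube m → p ξ :=
    ae_all_iff.2 fun m => (ae_restrict_iff' (measurableSet_cube m)).1 (h m)
  filter_upwards [this] with ξ hξ
  obtain ⟨m, hm⟩ := exists_mem_cube ξ
  exact hξ m hm

/-- The Fourier transform of `v` vanishes outside of `cube m`. -/
def BandLimited (m : Fin d → ℤ) (v : L2 d) : Prop :=
  ∀ᵐ ξ, ξ ∉ cube m → (𝓕 v : L2 d) ξ = 0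

/-- Plancherel turns the translation into a character and confines the integral to `cube m`.
Characters of integer points have integer periods, so moving to `cube 0` makes the inner product the
conjugate of a Fourier coefficient. -/
theorem inner_translation (m z : Fin d → ℤ) (F v : L2 d) (hv : BandLimited m v) :
    inner ℂ (translation (intPt z) F) v = (starRingEnd ℂ) (∫ ξ in cube 0, char (intPt z) ξ *
      ((starRingEnd ℂ) ((𝓕 v : L2 d) (ξ + intPt m)) * (𝓕 F : L2 d) (ξ + intPt m))) := by
  rw [← inner_conj_symm]
  congr 1
  rw [← Lp.inner_fourier_eq, fourier_translation, L2.inner_def]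
  have h : (fun ξ => inner ℂ ((𝓕 v : L2 d) ξ) (modulation (intPt z) (𝓕 F) ξ)) =ᵐ[volume]
      fun ξ => char (intPt z) ξ * ((starRingEnd ℂ) ((𝓕 v : L2 d) ξ) * (𝓕 F : L2 d) ξ) := by
    filter_upwards [modulation_ae (intPt z) (𝓕 F)] with ξ h
    rw [h, RCLike.inner_apply]
    ring
  rw [integral_congr_ae h, ← setIntegral_eq_integral_of_ae_compl_eq_zero (s := cube m),
    setIntegral_cube_eq]
  · simp only [char_intPt_add_intPt]
  · filter_upwards [hv] with ξ h hξ
    rw [h hξ, map_zero, zero_mul, mul_zero]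

theorem memLp_comp_add_intPt (m : Fin d → ℤ) (f : L2 d) :
    MemLp (fun ξ => f (ξ + intPt m)) 2 (volume.restrict (cube 0)) :=
  ((Lp.memLp f).restrict (cube m)).comp_measurePreserving (measurePreserving_add_intPt m)

/-- Although v and w live on different cubes, both factors become Fourier coefficients on `cube 0`,
and Parseval applies. This is where correlations at points differing by n - m arise. -/
theorem hasSum_inner_translation {m n : Fin d → ℤ} {F G v w : L2 d}
    (hv : BandLimited m v) (hw : BandLimited n w)
    (hF : MemLp (fun ξ => (starRingEnd ℂ) ((𝓕 v : L2 d) (ξ + intPt m)) *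
      (𝓕 F : L2 d) (ξ + intPt m)) 2 (volume.restrict (cube 0)))
    (hG : MemLp (fun ξ => (starRingEnd ℂ) ((𝓕 w : L2 d) (ξ + intPt n)) *
      (𝓕 G : L2 d) (ξ + intPt n)) 2 (volume.restrict (cube 0))) :
    HasSum (fun z : Fin d → ℤ => inner ℂ (translation (intPt z) F) v *
        inner ℂ w (translation (intPt z) G))
      (∫ ξ in cube 0, ((𝓕 v : L2 d) (ξ + intPt m) * (starRingEnd ℂ) ((𝓕 w : L2 d) (ξ + intPt n))) *
        ((starRingEnd ℂ) ((𝓕 F : L2 d) (ξ + intPt m)) * (𝓕 G : L2 d) (ξ + intPt n))) := by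
  convert hasSum_fourier_cube hF hG using 1
  · ext z
    rw [inner_translation m z F v hv, ← inner_conj_symm w, inner_translation n z G w hw,
      Complex.conj_conj]
  · refine integral_congr_ae (.of_forall fun ξ => ?_)
    simp only [map_mul, Complex.conj_conj]
    ring

/-- The alternative lets F̂ be unbounded off the support of v̂. This is needed before essential
boundedness of F̂ is known. -/
theorem memLp_conj_mul_of_bound {m : Fin d → ℤ} {F v : L2 d} {C : ℝ}
    (h : ∀ᵐ ξ ∂(volume.restrict (cube 0)), (𝓕 v : L2 d) (ξ + intPt m) = 0 ∨
      ‖(𝓕 F : L2 d) (ξ + intPt m)‖ ≤ C) :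
    MemLp (fun ξ => (starRingEnd ℂ) ((𝓕 v : L2 d) (ξ + intPt m)) *
      (𝓕 F : L2 d) (ξ + intPt m)) 2 (volume.restrict (cube 0)) := by
  have hv := memLp_comp_add_intPt m (𝓕 v : L2 d)
  refine hv.of_le_mul (c := C) ((Complex.continuous_conj.comp_aestronglyMeasurable hv.1).mul
    (memLp_comp_add_intPt m (𝓕 F : L2 d)).1) ?_
  filter_upwards [h] with ξ hξ
  rw [norm_mul, RCLike.norm_conj, mul_comm]
  rcases hξ with h | h
  · simp [h]
  · exact mul_le_mul_of_nonneg_right h (norm_nonneg _)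

/-- The function in `L²` whose Fourier transform is the indicator function of `E`. -/
def bandIndicator (E : Set (Eu d)) (hE : MeasurableSet E) (hE' : volume E ≠ ⊤) : L2 d :=
  𝓕⁻ (indicatorConstLp 2 hE hE' (1 : ℂ) : L2 d)

theorem fourier_bandIndicator_ae (E : Set (Eu d)) (hE : MeasurableSet E) (hE' : volume E ≠ ⊤) :
    ∀ᵐ ξ, (𝓕 (bandIndicator E hE hE') : L2 d) ξ = E.indicator (fun _ => (1 : ℂ)) ξ := by
  rw [bandIndicator, FourierTransform.fourier_fourierInv_eq]
  exact indicatorConstLp_coeFn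

theorem bandLimited_bandIndicator {m : Fin d → ℤ} (E : Set (Eu d)) (hE : MeasurableSet E)
    (hE' : volume E ≠ ⊤) (hm : E ⊆ cube m) : BandLimited m (bandIndicator E hE hE') := by
  filter_upwards [fourier_bandIndicator_ae E hE hE'] with ξ h hξ
  rw [h, Set.indicator_of_notMem fun h' => hξ (hm h')]

theorem norm_bandIndicator_sq (E : Set (Eu d)) (hE : MeasurableSet E) (hE' : volume E ≠ ⊤) :
    ‖bandIndicator E hE hE'‖ ^ 2 = volume.real E := by
  rw [← Lp.norm_fourier_eq, bandIndicator, FourierTransform.fourier_fourierInv_eq,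
    norm_indicatorConstLp (by norm_num) (by norm_num), norm_one, one_mul, ← Real.rpow_natCast,
    ← Real.rpow_mul measureReal_nonneg]
  norm_num

/-- Testing against the v with v̂ = û on `cube m` and v̂ = 0 elsewhere gives ⟨v, u⟩ = ‖v‖², so û
vanishes on each cube. -/
theorem eq_zero_of_forall_bandLimited {u : L2 d}
    (h : ∀ v ∈ {v : L2 d | ∃ m, BandLimited m v}, inner ℂ v u = 0) : u = 0 := by
  have h1 : ∀ m : Fin d → ℤ, ∀ᵐ ξ ∂(volume.restrict (cube m)), (𝓕 u : L2 d) ξ = 0 := by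
    intro m
    have hL : MemLp ((cube m).indicator (𝓕 u : L2 d)) 2 volume :=
      (Lp.memLp _).indicator (measurableSet_cube m)
    have hv : BandLimited m (𝓕⁻ (hL.toLp : L2 d)) := by
      rw [BandLimited, FourierTransform.fourier_fourierInv_eq]
      filter_upwards [hL.coeFn_toLp] with ξ h hξ
      rw [h, Set.indicator_of_notMem hξ]
    have h2 := h _ ⟨m, hv⟩
    rw [← Lp.inner_fourier_eq, FourierTransform.fourier_fourierInv_eq, L2.inner_def] at h2
    have h3 : inner ℂ (hL.toLp : L2 d) (hL.toLp : L2 d) = 0 := by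
      rw [← h2, L2.inner_def]
      refine integral_congr_ae ?_
      filter_upwards [hL.coeFn_toLp] with ξ h
      rw [h]
      by_cases hξ : ξ ∈ cube m
      · rw [Set.indicator_of_mem hξ]
      · rw [Set.indicator_of_notMem hξ, inner_zero_left, inner_zero_left]
    rw [inner_self_eq_zero] at h3
    have h4 := hL.coeFn_toLp
    rw [h3] at h4
    rw [ae_restrict_iff' (measurableSet_cube m)]
    filter_upwards [h4, Lp.coeFn_zero ℂ 2 (volume : Measure (Eu d))] with ξ h5 h6 hξ
    rw [h6, Set.indicator_of_mem hξ] at h5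
    exact h5.symm
  have h2 : (𝓕 u : L2 d) = 0 := by
    apply Lp.ext
    filter_upwards [ae_of_forall_ae_restrict_cube h1, Lp.coeFn_zero ℂ 2 (volume : Measure (Eu d))]
      with ξ h h'
    rw [h, h', Pi.zero_apply]
  rw [← norm_eq_zero, ← Lp.norm_fourier_eq, h2, norm_zero]

end

/-! ### Bessel systems of translates have bounded fibers -/

section

variable {d : ℕ} {Γ : Type*}

/-- The system of integer translates of the family `F`. -/
def shiftSystem (F : Γ → L2 d) : (Fin d → ℤ) × Γ → L2 d :=
  fun p => translation (intPt p.1) (F p.2)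

/-- The diagonal case of `hasSum_inner_translation`. The bound N only secures square integrability
and leaves no trace in the value. -/
theorem hasSum_norm_inner_translation_sq {m : Fin d → ℤ} {E : Set (Eu d)}
    (hE : MeasurableSet E) (hE' : volume E ≠ ⊤) (hm : E ⊆ cube m) {F : L2 d} {N : ℝ}
    (hN : ∀ ξ ∈ E, ‖(𝓕 F : L2 d) ξ‖ ≤ N) :
    HasSum (fun z : Fin d → ℤ =>
      ‖inner ℂ (translation (intPt z) F) (bandIndicator E hE hE')‖ ^ 2)
      (∫ ξ in E, ‖(𝓕 F : L2 d) ξ‖ ^ 2) := by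
  have hv := bandLimited_bandIndicator E hE hE' hm
  have hL : MemLp (fun ξ => (starRingEnd ℂ) ((𝓕 (bandIndicator E hE hE') : L2 d) (ξ + intPt m)) *
      (𝓕 F : L2 d) (ξ + intPt m)) 2 (volume.restrict (cube 0)) := by
    refine memLp_conj_mul_of_bound (C := N) ?_
    rw [ae_restrict_cube_iff m fun ξ => (𝓕 (bandIndicator E hE hE') : L2 d) ξ = 0 ∨
      ‖(𝓕 F : L2 d) ξ‖ ≤ N]
    filter_upwards [ae_restrict_of_ae (fourier_bandIndicator_ae E hE hE')] with ξ h
    by_cases hξ : ξ ∈ E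
    · exact .inr (hN ξ hξ)
    · exact .inl (by rw [h, Set.indicator_of_notMem hξ])
  have h := hasSum_inner_translation hv hv hL hL
  have h2 : (∫ ξ in cube 0, ((𝓕 (bandIndicator E hE hE') : L2 d) (ξ + intPt m) *
      (starRingEnd ℂ) ((𝓕 (bandIndicator E hE hE') : L2 d) (ξ + intPt m))) *
        ((starRingEnd ℂ) ((𝓕 F : L2 d) (ξ + intPt m)) * (𝓕 F : L2 d) (ξ + intPt m))) =
      ((∫ ξ in E, ‖(𝓕 F : L2 d) ξ‖ ^ 2 : ℝ) : ℂ) := by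
    rw [← setIntegral_cube_eq m fun ξ => ((𝓕 (bandIndicator E hE hE') : L2 d) ξ *
      (starRingEnd ℂ) ((𝓕 (bandIndicator E hE hE') : L2 d) ξ)) *
        ((starRingEnd ℂ) ((𝓕 F : L2 d) ξ) * (𝓕 F : L2 d) ξ), ← integral_complex_ofReal]
    have hind : ∀ f : Eu d → ℂ, ∫ ξ in E, f ξ = ∫ ξ in cube m, E.indicator f ξ := fun f => by
      rw [setIntegral_indicator hE, Set.inter_eq_self_of_subset_right hm]
    rw [hind]
    refine integral_congr_ae ?_
    filter_upwards [ae_restrict_of_ae (fourier_bandIndicator_ae E hE hE')] with ξ h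
    rw [h]
    by_cases hξ : ξ ∈ E
    · rw [Set.indicator_of_mem hξ, Set.indicator_of_mem hξ, map_one, one_mul, one_mul,
        Complex.conj_mul']
      push_cast
      rfl
    · rw [Set.indicator_of_notMem hξ, Set.indicator_of_notMem hξ, zero_mul, zero_mul]
  rw [h2] at h
  rw [← Complex.hasSum_ofReal]
  convert h using 1
  ext z
  rw [← inner_conj_symm (bandIndicator E hE hE'), Complex.mul_conj']
  push_cast
  rfl

/-- Testing the Bessel inequality on the indicator of a set E where the sum exceeds C gives ∫_E ∑
|F̂_γ|² ≤ C |E|, which forces |E| = 0. -/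
theorem sum_norm_fourier_sq_le {F : Γ → L2 d} {C : ℝ}
    (hC : ∀ v : L2 d, Summable (fun j => ‖inner ℂ (shiftSystem F j) v‖ ^ 2) ∧
      ∑' j, ‖inner ℂ (shiftSystem F j) v‖ ^ 2 ≤ C * ‖v‖ ^ 2) (s : Finset Γ) (m : Fin d → ℤ) :
    ∀ᵐ ξ ∂(volume.restrict (cube m)), ∑ γ ∈ s, ‖(𝓕 (F γ) : L2 d) ξ‖ ^ 2 ≤ C := by
  have hmeas : ∀ γ, Measurable fun ξ => ‖(𝓕 (F γ) : L2 d) ξ‖ := fun γ =>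
    (Lp.stronglyMeasurable (𝓕 (F γ) : L2 d)).norm.measurable
  have hmeas' : Measurable fun ξ => ∑ γ ∈ s, ‖(𝓕 (F γ) : L2 d) ξ‖ ^ 2 :=
    Finset.measurable_fun_sum _ fun γ _ => (hmeas γ).pow_const 2
  -- Truncation at height N makes the F̂_γ bounded on E. The values are finite, so each ξ is covered
  -- by some N.
  have key : ∀ N : ℕ, ∀ᵐ ξ ∂(volume.restrict (cube m)),
      (∀ γ ∈ s, ‖(𝓕 (F γ) : L2 d) ξ‖ ≤ N) → ∑ γ ∈ s, ‖(𝓕 (F γ) : L2 d) ξ‖ ^ 2 ≤ C := by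
    intro N
    set E : Set (Eu d) := (cube m ∩ ⋂ γ ∈ s, {ξ | ‖(𝓕 (F γ) : L2 d) ξ‖ ≤ N}) ∩
      {ξ | C < ∑ γ ∈ s, ‖(𝓕 (F γ) : L2 d) ξ‖ ^ 2} with hEdef
    have hE : MeasurableSet E := ((measurableSet_cube m).inter
      (s.measurableSet_biInter fun γ _ => measurableSet_le (hmeas γ) measurable_const)).inter
      (measurableSet_lt measurable_const hmeas')
    have hEm : E ⊆ cube m := fun ξ h => h.1.1
    have hE' : volume E ≠ ⊤ := ((measure_mono hEm).trans_lt (volume_cube_lt_top m)).ne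
    have hN : ∀ γ ∈ s, ∀ ξ ∈ E, ‖(𝓕 (F γ) : L2 d) ξ‖ ≤ N := fun γ hγ ξ hξ =>
      Set.mem_iInter₂.1 hξ.1.2 γ hγ
    have hint : ∀ γ, IntegrableOn (fun ξ => ‖(𝓕 (F γ) : L2 d) ξ‖ ^ 2) E := fun γ =>
      ((Lp.memLp (𝓕 (F γ) : L2 d)).integrable_norm_pow (by norm_num)).integrableOn
    have hle : ∫ ξ in E, ∑ γ ∈ s, ‖(𝓕 (F γ) : L2 d) ξ‖ ^ 2 ≤ ∫ ξ in E, C := by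
      rw [integral_finsetSum _ fun γ _ => hint γ, setIntegral_const, smul_eq_mul, mul_comm,
        ← norm_bandIndicator_sq E hE hE']
      obtain ⟨hsum, hbound⟩ := hC (bandIndicator E hE hE')
      refine le_trans ?_ hbound
      rw [← (Equiv.prodComm Γ (Fin d → ℤ)).tsum_eq]
      have hsum' : Summable fun p : Γ × (Fin d → ℤ) =>
          ‖inner ℂ (translation (intPt p.2) (F p.1)) (bandIndicator E hE hE')‖ ^ 2 :=
        (Equiv.prodComm Γ (Fin d → ℤ)).summable_iff.2 hsum
      refine le_trans ?_ (hsum'.tsum_prod).ge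
      refine le_trans (Finset.sum_le_sum fun γ hγ => ?_)
        (hsum'.prod.sum_le_tsum s fun γ _ => tsum_nonneg fun _ => by positivity)
      exact (hasSum_norm_inner_translation_sq hE hE' hEm (hN γ hγ)).tsum_eq.ge
    have hnull : volume E = 0 := by
      by_contra hpos
      have : 0 < ∫ ξ in E, (∑ γ ∈ s, ‖(𝓕 (F γ) : L2 d) ξ‖ ^ 2 - C) := by
        rw [setIntegral_pos_iff_support_of_nonneg_ae]
        · refine pos_iff_ne_zero.2 fun h0 => hpos (measure_mono_null ?_ h0)
          refine fun ξ hξ => ⟨?_, hξ⟩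
          exact (sub_pos.2 (show C < _ from hξ.2)).ne'
        · filter_upwards [ae_restrict_mem hE] with ξ hξ
          exact (sub_pos.2 hξ.2).le
        · exact (integrable_finsetSum _ fun γ _ => hint γ).sub (integrableOn_const hE')
      rw [integral_sub (integrable_finsetSum _ fun γ _ => hint γ) (integrableOn_const hE')] at this
      linarith
    rw [ae_restrict_iff' (measurableSet_cube m)]
    have : ∀ᵐ ξ, ξ ∉ E := measure_eq_zero_iff_ae_notMem.1 hnull
    filter_upwards [this] with ξ hξ hm hb
    by_contra hlt
    exact hξ ⟨⟨hm, Set.mem_iInter₂.2 hb⟩, not_le.1 hlt⟩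
  filter_upwards [ae_all_iff.2 key] with ξ h
  obtain ⟨N, hN⟩ := exists_nat_ge (∑ γ ∈ s, ‖(𝓕 (F γ) : L2 d) ξ‖)
  exact h N fun γ hγ => (Finset.single_le_sum (f := fun γ => ‖(𝓕 (F γ) : L2 d) ξ‖)
    (fun _ _ => norm_nonneg _) hγ).trans hN

/-- The integer translates of a countable family `F` are Bessel only if `∑ |F̂_γ|²` is essentially
bounded. -/
theorem IsBessel.exists_fourier_bound [Countable Γ] {F : Γ → L2 d} (hF : IsBessel (shiftSystem F)) :
    ∃ C : ℝ, ∀ᵐ ξ, ∀ s : Finset Γ, ∑ γ ∈ s, ‖(𝓕 (F γ) : L2 d) ξ‖ ^ 2 ≤ C := by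
  obtain ⟨C, hC⟩ := hF
  exact ⟨C, ae_all_iff.2 fun s => ae_of_forall_ae_restrict_cube fun m =>
    sum_norm_fourier_sq_le hC s m⟩

theorem summable_mul_of_sum_sq_le {f g : Γ → ℂ} {C C' : ℝ}
    (hf : ∀ s : Finset Γ, ∑ γ ∈ s, ‖f γ‖ ^ 2 ≤ C) (hg : ∀ s : Finset Γ, ∑ γ ∈ s, ‖g γ‖ ^ 2 ≤ C') :
    Summable fun γ => (starRingEnd ℂ) (f γ) * g γ := by
  have hf' := summable_of_sum_le (f := fun γ => ‖f γ‖ ^ 2) (fun _ => by positivity) hf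
  have hg' := summable_of_sum_le (f := fun γ => ‖g γ‖ ^ 2) (fun _ => by positivity) hg
  refine Summable.of_norm_bounded (hf'.add hg') fun γ => ?_
  rw [norm_mul, RCLike.norm_conj]
  nlinarith [sq_nonneg (‖f γ‖ - ‖g γ‖), sq_nonneg ‖f γ‖, sq_nonneg ‖g γ‖]

theorem tsum_enorm_mul_le {f g : Γ → ℂ} {C C' : ℝ}
    (hf : ∀ s : Finset Γ, ∑ γ ∈ s, ‖f γ‖ ^ 2 ≤ C) (hg : ∀ s : Finset Γ, ∑ γ ∈ s, ‖g γ‖ ^ 2 ≤ C') :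
    ∑' γ, ‖(starRingEnd ℂ) (f γ) * g γ‖ₑ ≤ ENNReal.ofReal (C + C') := by
  rw [ENNReal.tsum_eq_iSup_sum]
  refine iSup_le fun s => ?_
  simp_rw [← ofReal_norm]
  rw [← ENNReal.ofReal_sum_of_nonneg fun _ _ => norm_nonneg _]
  refine ENNReal.ofReal_le_ofReal ?_
  refine le_trans ?_ (add_le_add (hf s) (hg s))
  rw [← Finset.sum_add_distrib]
  refine Finset.sum_le_sum fun γ _ => ?_
  rw [norm_mul, RCLike.norm_conj]
  nlinarith [sq_nonneg (‖f γ‖ - ‖g γ‖), sq_nonneg ‖f γ‖, sq_nonneg ‖g γ‖]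

theorem ae_add_intPt {p : Eu d → Prop} (h : ∀ᵐ ξ, p ξ) (k : Fin d → ℤ) :
    ∀ᵐ ξ, p (ξ + intPt k) :=
  (measurePreserving_add_right volume (intPt k)).quasiMeasurePreserving.ae h

theorem IsBessel.ae_summable_fourier [Countable Γ] {F G : Γ → L2 d}
    (hF : IsBessel (shiftSystem F)) (hG : IsBessel (shiftSystem G)) (k : Fin d → ℤ) :
    ∀ᵐ ξ, Summable fun γ => (starRingEnd ℂ) ((𝓕 (F γ) : L2 d) ξ) *
      (𝓕 (G γ) : L2 d) (ξ + intPt k) := by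
  obtain ⟨C, hC⟩ := hF.exists_fourier_bound
  obtain ⟨C', hC'⟩ := hG.exists_fourier_bound
  filter_upwards [hC, ae_add_intPt hC' k] with ξ h h'
  exact summable_mul_of_sum_sq_le h h'

end

/-! ### Orthogonality of systems of translates -/

section

variable {d : ℕ} {Γ : Type*}

theorem ae_restrict_cube_zero_of_ae {p : Eu d → Prop} (h : ∀ᵐ ξ, p ξ) (m : Fin d → ℤ) :
    ∀ᵐ ξ ∂(volume.restrict (cube 0)), p (ξ + intPt m) :=
  ae_restrict_of_ae (ae_add_intPt h m)

theorem norm_le_of_sum_sq_le {f : Γ → ℂ} {C : ℝ} (hf : ∀ s : Finset Γ, ∑ γ ∈ s, ‖f γ‖ ^ 2 ≤ C)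
    (γ : Γ) : ‖f γ‖ ≤ √C := by
  refine Real.le_sqrt_of_sq_le ?_
  simpa using hf {γ}

/-- For fixed γ, Parseval sums over the translations. The sum over γ then enters the integral by
domination: ∑ |F̂_γ Ĝ_γ| is essentially bounded by C + C', and v̂ times the conjugate of ŵ is
integrable. -/
theorem tsum_inner_shiftSystem [Countable Γ] {F G : Γ → L2 d}
    (hF : IsBessel (shiftSystem F)) (hG : IsBessel (shiftSystem G)) {m n : Fin d → ℤ} {v w : L2 d}
    (hv : BandLimited m v) (hw : BandLimited n w) :
    ∑' p, inner ℂ (shiftSystem F p) v * inner ℂ w (shiftSystem G p) =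
      ∫ ξ in cube 0, ((𝓕 v : L2 d) (ξ + intPt m) * (starRingEnd ℂ) ((𝓕 w : L2 d) (ξ + intPt n))) *
        ∑' γ, (starRingEnd ℂ) ((𝓕 (F γ) : L2 d) (ξ + intPt m)) *
          (𝓕 (G γ) : L2 d) (ξ + intPt n) := by
  obtain ⟨C, hC⟩ := hF.exists_fourier_bound
  obtain ⟨C', hC'⟩ := hG.exists_fourier_bound
  have hCm := ae_restrict_cube_zero_of_ae hC m
  have hCn := ae_restrict_cube_zero_of_ae hC' n
  have hLF : ∀ γ, MemLp (fun ξ => (starRingEnd ℂ) ((𝓕 v : L2 d) (ξ + intPt m)) *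
      (𝓕 (F γ) : L2 d) (ξ + intPt m)) 2 (volume.restrict (cube 0)) := fun γ =>
    memLp_conj_mul_of_bound (by
      filter_upwards [hCm] with ξ h using .inr (norm_le_of_sum_sq_le h γ))
  have hLG : ∀ γ, MemLp (fun ξ => (starRingEnd ℂ) ((𝓕 w : L2 d) (ξ + intPt n)) *
      (𝓕 (G γ) : L2 d) (ξ + intPt n)) 2 (volume.restrict (cube 0)) := fun γ =>
    memLp_conj_mul_of_bound (by
      filter_upwards [hCn] with ξ h using .inr (norm_le_of_sum_sq_le h γ))
  have hsum := (hF.hasSum_inner_mixed hG v w).summable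
  have hsum' : Summable fun p : Γ × (Fin d → ℤ) =>
      inner ℂ (translation (intPt p.2) (F p.1)) v * inner ℂ w (translation (intPt p.2) (G p.1)) :=
    (Equiv.prodComm Γ (Fin d → ℤ)).summable_iff.2 hsum
  rw [← (Equiv.prodComm Γ (Fin d → ℤ)).tsum_eq]
  refine (hsum'.tsum_prod).trans ?_
  have h1 := fun γ => (hasSum_inner_translation hv hw (hLF γ) (hLG γ)).tsum_eq
  simp only [h1]
  have hvm := memLp_comp_add_intPt m (𝓕 v : L2 d)
  have hwn := memLp_comp_add_intPt n (𝓕 w : L2 d)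
  have hvw : Integrable (fun ξ => (𝓕 v : L2 d) (ξ + intPt m) *
      (starRingEnd ℂ) ((𝓕 w : L2 d) (ξ + intPt n))) (volume.restrict (cube 0)) :=
    MemLp.integrable_mul (p := 2) (q := 2) hvm hwn.star
  simp_rw [← tsum_mul_left]
  rw [integral_tsum]
  · intro γ
    exact hvw.1.mul ((Complex.continuous_conj.comp_aestronglyMeasurable
      (memLp_comp_add_intPt m (𝓕 (F γ) : L2 d)).1).mul (memLp_comp_add_intPt n (𝓕 (G γ) : L2 d)).1)
  · rw [← lintegral_tsum]
    · refine ne_top_of_le_ne_top (b := (∫⁻ ξ in cube 0, ‖(𝓕 v : L2 d) (ξ + intPt m) *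
        (starRingEnd ℂ) ((𝓕 w : L2 d) (ξ + intPt n))‖ₑ) * ENNReal.ofReal (C + C'))
        (ENNReal.mul_ne_top hvw.2.ne ENNReal.ofReal_ne_top) ?_
      rw [← lintegral_mul_const' _ _ ENNReal.ofReal_ne_top]
      refine lintegral_mono_ae ?_
      filter_upwards [hCm, hCn] with ξ h h'
      simp_rw [enorm_mul (_ * _) (_ * _)]
      rw [ENNReal.tsum_mul_left]
      gcongr
      exact tsum_enorm_mul_le h h'
    · intro γ
      exact (hvw.1.mul ((Complex.continuous_conj.comp_aestronglyMeasurable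
        (memLp_comp_add_intPt m (𝓕 (F γ) : L2 d)).1).mul
        (memLp_comp_add_intPt n (𝓕 (G γ) : L2 d)).1)).enorm

theorem integrable_tsum_fourier [Countable Γ] {F G : Γ → L2 d}
    (hF : IsBessel (shiftSystem F)) (hG : IsBessel (shiftSystem G)) (m n : Fin d → ℤ) :
    Integrable (fun ξ => ∑' γ, (starRingEnd ℂ) ((𝓕 (F γ) : L2 d) (ξ + intPt m)) *
      (𝓕 (G γ) : L2 d) (ξ + intPt n)) (volume.restrict (cube 0)) := by
  obtain ⟨C, hC⟩ := hF.exists_fourier_bound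
  obtain ⟨C', hC'⟩ := hG.exists_fourier_bound
  have hCm := ae_restrict_cube_zero_of_ae hC m
  have hCn := ae_restrict_cube_zero_of_ae hC' n
  have hfin : IsFiniteMeasure ((volume : Measure (Eu d)).restrict (cube 0)) :=
    ⟨by rw [Measure.restrict_apply_univ]; exact volume_cube_lt_top 0⟩
  refine Integrable.of_bound (C := max (C + C') 0) ?_ ?_
  · refine aestronglyMeasurable_of_tendsto_ae Filter.atTop (f := fun (s : Finset Γ) ξ => ∑ γ ∈ s,
      (starRingEnd ℂ) ((𝓕 (F γ) : L2 d) (ξ + intPt m)) * (𝓕 (G γ) : L2 d) (ξ + intPt n)) ?_ ?_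
    · intro s
      refine Finset.aestronglyMeasurable_fun_sum _ fun γ _ => ?_
      exact (Complex.continuous_conj.comp_aestronglyMeasurable
        (memLp_comp_add_intPt m (𝓕 (F γ) : L2 d)).1).mul (memLp_comp_add_intPt n (𝓕 (G γ) : L2 d)).1
    · filter_upwards [hCm, hCn] with ξ h h'
      exact (summable_mul_of_sum_sq_le h h').hasSum
  · filter_upwards [hCm, hCn] with ξ h h'
    rw [← toReal_enorm]
    refine ENNReal.toReal_le_of_le_ofReal (le_max_right _ _) ?_
    refine (enorm_tsum_le_tsum_enorm).trans ((tsum_enorm_mul_le h h').trans ?_)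
    exact ENNReal.ofReal_le_ofReal (le_max_left _ _)

/-- Two countably generated systems of integer translates are orthogonal if and only if all the
fiberwise mixed correlations of the Fourier transforms of their generators vanish. -/
theorem areOrthogonal_shiftSystem_iff [Countable Γ] {F G : Γ → L2 d}
    (hF : IsBessel (shiftSystem F)) (hG : IsBessel (shiftSystem G)) :
    AreOrthogonal (shiftSystem F) (shiftSystem G) ↔ ∀ k : Fin d → ℤ, ∀ᵐ ξ,
      ∑' γ, (starRingEnd ℂ) ((𝓕 (F γ) : L2 d) ξ) * (𝓕 (G γ) : L2 d) (ξ + intPt k) = 0 := by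
  rw [areOrthogonal_iff_of_total hF hG (D := {v : L2 d | ∃ m, BandLimited m v})
    fun u hu => eq_zero_of_forall_bandLimited hu]
  constructor
  · intro h k
    refine ae_of_forall_ae_restrict_cube fun m => ?_
    rw [← ae_restrict_cube_iff]
    simp only [add_assoc, ← intPt_add]
    refine Integrable.ae_eq_zero_of_forall_setIntegral_eq_zero
      (integrable_tsum_fourier hF hG m (m + k)) fun E hE _ => ?_
    -- Take v̂ to be the indicator of E ∩ `cube 0` moved to `cube m`, and ŵ that of `cube (m + k)`.
    -- The pairing is then the integral of the k-th correlation over E ∩ `cube 0`.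
    have hE1 : MeasurableSet ((fun ξ => ξ - intPt m) ⁻¹' (E ∩ cube 0)) :=
      (hE.inter (measurableSet_cube 0)).preimage (measurable_sub_const _)
    have hE2 : (fun ξ => ξ - intPt m) ⁻¹' (E ∩ cube 0) ⊆ cube m := fun ξ hξ => by
      rw [← sub_add_cancel ξ (intPt m), add_intPt_mem_cube_iff]
      exact hξ.2
    have hE3 : volume ((fun ξ => ξ - intPt m) ⁻¹' (E ∩ cube 0)) ≠ ⊤ :=
      ((measure_mono hE2).trans_lt (volume_cube_lt_top m)).ne
    have hc := (volume_cube_lt_top (m + k)).ne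
    have h1 := h _ ⟨m, bandLimited_bandIndicator _ hE1 hE3 hE2⟩ _
      ⟨m + k, bandLimited_bandIndicator _ (measurableSet_cube (m + k)) hc subset_rfl⟩
    rw [tsum_inner_shiftSystem hF hG (bandLimited_bandIndicator _ hE1 hE3 hE2)
      (bandLimited_bandIndicator _ (measurableSet_cube (m + k)) hc subset_rfl)] at h1
    rw [← h1, ← integral_indicator hE]
    refine integral_congr_ae ?_
    filter_upwards [ae_restrict_cube_zero_of_ae (fourier_bandIndicator_ae _ hE1 hE3) m,
      ae_restrict_cube_zero_of_ae (fourier_bandIndicator_ae _ (measurableSet_cube (m + k)) hc)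
        (m + k), ae_restrict_mem (measurableSet_cube 0)] with ξ h2 h3 h4
    rw [h2, h3, Set.indicator_of_mem ((add_intPt_mem_cube_iff _ _).2 h4), map_one, mul_one]
    by_cases hξ : ξ ∈ E
    · rw [Set.indicator_of_mem hξ, Set.indicator_of_mem, one_mul]
      simpa using ⟨hξ, h4⟩
    · rw [Set.indicator_of_notMem hξ, Set.indicator_of_notMem, zero_mul]
      simpa using fun h => absurd h hξ
  · rintro h v ⟨m, hv⟩ w ⟨n, hw⟩
    rw [tsum_inner_shiftSystem hF hG hv hw]
    refine integral_eq_zero_of_ae ?_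
    filter_upwards [ae_restrict_cube_zero_of_ae (h (n - m)) m] with ξ h1
    rw [add_assoc, ← intPt_add, add_sub_cancel] at h1
    rw [h1, mul_zero, Pi.zero_apply]

end

/-! ### Commutation relations, dual dilations and periods -/

section

variable {d : ℕ}

theorem translation_translation (a b : Eu d) (f : L2 d) :
    translation a (translation b f) = translation (a + b) f := by
  apply Lp.ext
  filter_upwards [translation_ae a (translation b f), translation_ae (a + b) f,
    (measurePreserving_sub_right volume a).quasiMeasurePreserving.ae (translation_ae b f)]
    with x h1 h2 h3
  rw [h1, h2, h3, sub_sub]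

theorem compMat_translation (A : GL (Fin d) ℝ) (a : Eu d) (f : L2 d) :
    compMat A (translation (Matrix.toEuclideanLin (A : Matrix (Fin d) (Fin d) ℝ) a) f) =
      translation a (compMat A f) := by
  apply Lp.ext
  filter_upwards [compMat_ae A (translation (Matrix.toEuclideanLin
      (A : Matrix (Fin d) (Fin d) ℝ) a) f), translation_ae a (compMat A f),
    (quasiMP A).ae (translation_ae (Matrix.toEuclideanLin (A : Matrix (Fin d) (Fin d) ℝ) a) f),
    (measurePreserving_sub_right volume a).quasiMeasurePreserving.ae (compMat_ae A f)]
    with x h1 h2 h3 h4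
  rw [h1, h2, h3, h4, map_sub]

theorem dilation_translation (A : GL (Fin d) ℝ) (a : Eu d) (f : L2 d) :
    dilation A (translation (Matrix.toEuclideanLin (A : Matrix (Fin d) (Fin d) ℝ) a) f) =
      translation a (dilation A f) := by
  change ((√|(A : Matrix (Fin d) (Fin d) ℝ).det| : ℝ) : ℂ) • compMat A _ =
    translationIsometry a (((√|(A : Matrix (Fin d) (Fin d) ℝ).det| : ℝ) : ℂ) • compMat A f)
  rw [compMat_translation, map_smul, translationIsometry_apply]

/-- The transpose of an invertible matrix. -/
def transposeGL (A : GL (Fin d) ℝ) : GL (Fin d) ℝ where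
  val := (A : Matrix (Fin d) (Fin d) ℝ).transpose
  inv := ((A⁻¹ : GL (Fin d) ℝ) : Matrix (Fin d) (Fin d) ℝ).transpose
  val_inv := by rw [← Matrix.transpose_mul, ← Units.val_mul, inv_mul_cancel, Units.val_one,
    Matrix.transpose_one]
  inv_val := by rw [← Matrix.transpose_mul, ← Units.val_mul, mul_inv_cancel, Units.val_one,
    Matrix.transpose_one]

/-- The factor |det A| in D̃_A cancels the Jacobian from `fourier_compMat`, so no determinant
appears on the Fourier side. -/
theorem fourier_renormDilation_inv (A : GL (Fin d) ℝ) (f : L2 d) :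
    𝓕 ((renormDilation A)⁻¹ f) = compMat (transposeGL A) (𝓕 f) := by
  have h : ∀ g : L2 d, 𝓕 (renormDilation A g) = compMat (transposeGL A)⁻¹ (𝓕 g) := by
    intro g
    change 𝓕 (((|(A : Matrix (Fin d) (Fin d) ℝ).det| : ℝ) : ℂ) • compMat A g) = _
    rw [FourierTransform.fourier_smul, fourier_compMat A (transposeGL A)⁻¹,
      smul_inv_smul₀ (absDet_ne_zero A)]
    change ((A⁻¹ : GL (Fin d) ℝ) : Matrix (Fin d) (Fin d) ℝ).transpose.transpose * _ = 1
    rw [Matrix.transpose_transpose, ← Units.val_mul, inv_mul_cancel, Units.val_one]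
  have h1 := h ((renormDilation A)⁻¹ f)
  have h2 : renormDilation A ((renormDilation A)⁻¹ f) = f := (renormDilation A).apply_symm_apply f
  rw [h2] at h1
  rw [h1, compMat_compMat _ _ (inv_mul_cancel _)]

theorem fourier_renormDilation_zpow_ae (A : GL (Fin d) ℝ) (j : ℕ) (f : L2 d) :
    ∀ᵐ ξ, (𝓕 ((renormDilation A ^ (-(j : ℤ))) f) : L2 d) ξ = (𝓕 f : L2 d) (adjPow A j ξ) := by
  induction j with
  | zero => simp [adjPow]
  | succ j ih =>
    have h : (renormDilation A ^ (-((j + 1 : ℕ) : ℤ))) f =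
        (renormDilation A)⁻¹ ((renormDilation A ^ (-(j : ℤ))) f) := by
      rw [← LinearEquiv.mul_apply, ← zpow_neg_one, ← zpow_add]
      congr 2
      push_cast
      ring
    rw [h, fourier_renormDilation_inv]
    filter_upwards [compMat_ae (transposeGL A) (𝓕 ((renormDilation A ^ (-(j : ℤ))) f)),
      (quasiMP (transposeGL A)).ae ih] with ξ h1 h2
    rw [h1, h2, adjPow, adjPow, pow_succ, Matrix.toLpLin_mul_same]
    rfl

theorem volume_inner_eq_eq_zero {c : Eu d} (hc : c ≠ 0) (t : ℝ) :
    volume {ξ : Eu d | inner ℝ c ξ = t} = 0 := by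
  set L : Eu d →ₗ[ℝ] ℝ := innerₗ (Eu d) c
  have h : {ξ : Eu d | inner ℝ c ξ = t} ⊆
      ((AffineSubspace.mk' ((t / ‖c‖ ^ 2) • c) L.ker : AffineSubspace ℝ (Eu d)) : Set (Eu d)) := by
    intro ξ hξ
    rw [SetLike.mem_coe, AffineSubspace.mem_mk', LinearMap.mem_ker, vsub_eq_sub, map_sub]
    change inner ℝ c ξ - inner ℝ c _ = 0
    rw [inner_smul_right, real_inner_self_eq_norm_sq, div_mul_cancel₀ _ (by simpa using hc),
      sub_eq_zero]
    exact hξ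
  refine measure_mono_null h (Measure.addHaar_affineSubspace _ _ fun htop => hc ?_)
  have h1 := congrArg AffineSubspace.direction htop
  rw [AffineSubspace.direction_mk', AffineSubspace.direction_top] at h1
  have h2 : c ∈ L.ker := h1 ▸ Submodule.mem_top
  exact inner_self_eq_zero.1 (LinearMap.mem_ker.1 h2)

/-- A nonzero function in `L²(ℝ^d)` has no periods. -/
theorem eq_zero_of_translation_eq {a b : Eu d} (hab : a ≠ b) {g : L2 d}
    (h : translation a g = translation b g) : g = 0 := by
  have h1 : modulation a (𝓕 g) = modulation b (𝓕 g) := by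
    rw [← fourier_translation, h, fourier_translation]
  have h2 : (𝓕 g : L2 d) = 0 := by
    apply Lp.ext
    -- Where ĝ ≠ 0 the characters of a and b agree, that is ⟨a - b, ξ⟩ is an integer. These ξ form a
    -- countable union of hyperplanes, a null set.
    have h3 : ∀ᵐ ξ : Eu d, ∀ n : ℤ, ¬ inner ℝ (a - b) ξ = (n : ℝ) :=
      ae_all_iff.2 fun n =>
        measure_eq_zero_iff_ae_notMem.1 (volume_inner_eq_eq_zero (sub_ne_zero.2 hab) _)
    have h4 := modulation_ae a (𝓕 g)
    rw [h1] at h4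
    filter_upwards [h3, h4, modulation_ae b (𝓕 g), Lp.coeFn_zero ℂ 2 (volume : Measure (Eu d))]
      with ξ h5 h6 h7 h8
    rw [h8, Pi.zero_apply]
    by_contra hne
    rw [h7] at h6
    have h9 := mul_right_cancel₀ hne h6
    rw [char, char, Real.fourierChar_apply, Real.fourierChar_apply,
      Complex.exp_eq_exp_iff_exists_int] at h9
    obtain ⟨n, hn⟩ := h9
    refine h5 n ?_
    rw [inner_sub_left]
    have h10 : (2 * Real.pi * Complex.I : ℂ) ≠ 0 := Complex.two_pi_I_ne_zero
    have h11 : (2 * Real.pi * Complex.I : ℂ) * (((inner ℝ a ξ - inner ℝ b ξ : ℝ) : ℂ) - n) = 0 := by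
      push_cast at hn ⊢
      linear_combination hn
    have h12 := sub_eq_zero.1 ((mul_eq_zero.1 h11).resolve_left h10)
    exact_mod_cast h12
  rw [← norm_eq_zero, ← Lp.norm_fourier_eq, h2, norm_zero]

section Hilbert

variable {H : Type*} [NormedAddCommGroup H] [InnerProductSpace ℂ H] [CompleteSpace H] {K : Type*}

/-- The source of all intertwining relations: with U = D_A and V = D_B it links consecutive levels;
with U = V a translation and e a shift of indices it gives translation invariance. -/
theorem tsum_mixed_map {x y x' y' : K → H} (hx' : IsBessel x') (hy' : IsBessel y') (e : K ≃ K)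
    (U V : H →ₗᵢ[ℂ] H) (hU : ∀ k, x (e k) = U (x' k)) (hV : ∀ k, y (e k) = V (y' k)) (v : H) :
    ∑' k, inner ℂ (x k) (U v) • y k = V (∑' k, inner ℂ (x' k) v • y' k) := by
  rw [← e.tsum_eq]
  have := V.toContinuousLinearMap.map_tsum (hx'.summable_mixed hy' v)
  refine Eq.trans (tsum_congr fun k => ?_) this.symm
  rw [hU, hV, LinearIsometry.inner_map_map]
  exact (map_smul V _ _).symm

theorem IsBessel.tsum_mixed_int {x y : ℤ × K → H} (hx : IsBessel x) (hy : IsBessel y) (v : H) :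
    ∑' p, inner ℂ (x p) v • y p =
      (∑' n : ℕ, ∑' k, inner ℂ (x (n, k)) v • y (n, k)) +
        ∑' n : ℕ, ∑' k, inner ℂ (x (-((n : ℤ) + 1), k)) v • y (-((n : ℤ) + 1), k) := by
  have h := hx.summable_mixed hy v
  rw [h.tsum_prod]
  refine tsum_of_nat_of_neg_add_one ?_ ?_
  · exact h.prod.comp_injective Nat.cast_injective
  · exact h.prod.comp_injective fun a b hab => by simpa using hab

end Hilbert

end

/-! ### Levels of a quasi-affine system -/

section

variable {d r : ℕ}

theorem quasiAffine_zero (A : GL (Fin d) ℝ) (ψ : Fin r → L2 d) (k : (Fin d → ℤ) × Fin r) :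
    quasiAffine A ψ (0, k) = shiftSystem ψ k := by
  simp [quasiAffine, shiftSystem]

theorem quasiAffine_natCast_add_one (A : GL (Fin d) ℝ) (ψ : Fin r → L2 d) (n : ℕ)
    (k : (Fin d → ℤ) × Fin r) :
    quasiAffine A ψ ((n + 1 : ℕ), k) = dilationIsometry A (quasiAffine A ψ (n, k)) := by
  rw [quasiAffine, quasiAffine, if_pos (Int.natCast_nonneg _), if_pos (Int.natCast_nonneg _),
    zpow_natCast, zpow_natCast, pow_succ', LinearEquiv.mul_apply]
  rfl

/-- The generators of the part of negative levels of a quasi-affine system, as a shift invariant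
system. -/
def negGenerators (A : GL (Fin d) ℝ) (ψ : Fin r → L2 d) : ℕ × Fin r → L2 d :=
  fun p => (renormDilation A ^ (-((p.1 : ℤ) + 1))) (ψ p.2)

theorem quasiAffine_neg (A : GL (Fin d) ℝ) (ψ : Fin r → L2 d) (n : ℕ)
    (z : Fin d → ℤ) (i : Fin r) :
    quasiAffine A ψ (-((n : ℤ) + 1), z, i) = shiftSystem (negGenerators A ψ) (z, n, i) := by
  rw [quasiAffine, if_neg (by simp only; omega), shiftSystem, negGenerators]

theorem IsBessel.quasiAffine_level {A : GL (Fin d) ℝ} {ψ : Fin r → L2 d}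
    (h : IsBessel (quasiAffine A ψ)) (n : ℤ) : IsBessel fun k => quasiAffine A ψ (n, k) :=
  h.comp_injective (e := fun k => (n, k)) fun _ _ h => (Prod.mk.inj h).2

theorem IsBessel.shiftSystem_generators {A : GL (Fin d) ℝ} {ψ : Fin r → L2 d}
    (h : IsBessel (quasiAffine A ψ)) : IsBessel (shiftSystem ψ) := by
  simpa only [quasiAffine_zero] using h.quasiAffine_level 0

theorem IsBessel.shiftSystem_negGenerators {A : GL (Fin d) ℝ} {ψ : Fin r → L2 d}
    (h : IsBessel (quasiAffine A ψ)) : IsBessel (shiftSystem (negGenerators A ψ)) := by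
  have := h.comp_injective (e := fun p : (Fin d → ℤ) × ℕ × Fin r =>
    (-((p.2.1 : ℤ) + 1), p.1, p.2.2))
    fun p q hpq => by
      simp only [Prod.mk.injEq, neg_inj, add_left_inj, Nat.cast_inj] at hpq
      exact Prod.ext hpq.2.1 (Prod.ext hpq.1 hpq.2.2)
  convert this using 1
  ext1 p
  exact (quasiAffine_neg A ψ p.2.1 p.1 p.2.2).symm

/-- The contribution of level `n` to the mixed frame operator. -/
def levelOp (A B : GL (Fin d) ℝ) (ψ φ : Fin r → L2 d) (n : ℤ) (v : L2 d) : L2 d :=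
  ∑' k, inner ℂ (quasiAffine A ψ (n, k)) v • quasiAffine B φ (n, k)

section Operators

variable {A B : GL (Fin d) ℝ} {ψ φ : Fin r → L2 d}

theorem summable_levelOp (hψ : IsBessel (quasiAffine A ψ)) (hφ : IsBessel (quasiAffine B φ))
    (v : L2 d) : Summable fun n : ℤ => levelOp A B ψ φ n v :=
  (hψ.summable_mixed hφ v).prod

theorem levelOp_succ_dilation (hψ : IsBessel (quasiAffine A ψ)) (hφ : IsBessel (quasiAffine B φ))
    (n : ℕ) (v : L2 d) :
    levelOp A B ψ φ (n + 1 : ℕ) (dilationIsometry A v) =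
      dilationIsometry B (levelOp A B ψ φ n v) :=
  tsum_mixed_map (hψ.quasiAffine_level n) (hφ.quasiAffine_level n) (Equiv.refl _)
    (dilationIsometry A).toLinearIsometry (dilationIsometry B).toLinearIsometry
    (fun k => quasiAffine_natCast_add_one A ψ n k) (fun k => quasiAffine_natCast_add_one B φ n k) v

/-- At levels n ≤ 0 the translation is applied after the dilation, so integer translations only
permute the members. -/
theorem quasiAffine_add_intPt {n : ℤ} (hn : n ≤ 0) (a z : Fin d → ℤ) (i : Fin r) :
    quasiAffine A ψ (n, a + z, i) = translationIsometry (intPt a) (quasiAffine A ψ (n, z, i)) := by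
  rw [translationIsometry_apply]
  rcases hn.eq_or_lt with rfl | hn
  · rw [quasiAffine_zero, quasiAffine_zero, shiftSystem, shiftSystem, translation_translation,
      intPt_add]
  · rw [quasiAffine, quasiAffine, if_neg hn.not_ge, if_neg hn.not_ge, translation_translation,
      intPt_add]

theorem levelOp_translation (hψ : IsBessel (quasiAffine A ψ)) (hφ : IsBessel (quasiAffine B φ))
    {n : ℤ} (hn : n ≤ 0) (a : Fin d → ℤ) (v : L2 d) :
    levelOp A B ψ φ n (translationIsometry (intPt a) v) =
      translationIsometry (intPt a) (levelOp A B ψ φ n v) :=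
  tsum_mixed_map (hψ.quasiAffine_level n) (hφ.quasiAffine_level n)
    ((Equiv.addLeft a).prodCongr (Equiv.refl _))
    (translationIsometry (intPt a)) (translationIsometry (intPt a))
    (fun k => quasiAffine_add_intPt hn a k.1 k.2) (fun k => quasiAffine_add_intPt hn a k.1 k.2) v

theorem levelOp_zero_iff (hψ : IsBessel (quasiAffine A ψ)) (hφ : IsBessel (quasiAffine B φ)) :
    (∀ v, levelOp A B ψ φ 0 v = 0) ↔ AreOrthogonal (shiftSystem ψ) (shiftSystem φ) := by
  rw [areOrthogonal_iff_tsum hψ.shiftSystem_generators hφ.shiftSystem_generators]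
  simp only [levelOp, quasiAffine_zero]

theorem tsum_levelOp_neg_iff (hψ : IsBessel (quasiAffine A ψ)) (hφ : IsBessel (quasiAffine B φ)) :
    (∀ v, ∑' n : ℕ, levelOp A B ψ φ (-((n : ℤ) + 1)) v = 0) ↔
      AreOrthogonal (shiftSystem (negGenerators A ψ)) (shiftSystem (negGenerators B φ)) := by
  rw [areOrthogonal_iff_tsum hψ.shiftSystem_negGenerators hφ.shiftSystem_negGenerators]
  refine forall_congr' fun v => ?_
  let e : ℕ × (Fin d → ℤ) × Fin r ≃ (Fin d → ℤ) × ℕ × Fin r :=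
    ⟨fun p => (p.2.1, p.1, p.2.2), fun p => (p.2.1, p.1, p.2.2), fun _ => rfl, fun _ => rfl⟩
  have hs := e.summable_iff.2
    (hψ.shiftSystem_negGenerators.summable_mixed hφ.shiftSystem_negGenerators v)
  rw [← e.tsum_eq]
  have h1 : ∑' p : ℕ × (Fin d → ℤ) × Fin r, inner ℂ (shiftSystem (negGenerators A ψ) (e p)) v •
      shiftSystem (negGenerators B φ) (e p) = ∑' n : ℕ, levelOp A B ψ φ (-((n : ℤ) + 1)) v := by
    refine (hs.tsum_prod).trans (tsum_congr fun n => tsum_congr fun k => ?_)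
    rw [← Prod.mk.eta (p := k), quasiAffine_neg, quasiAffine_neg]
    rfl
  rw [h1]

theorem areOrthogonal_quasiAffine_iff_tsum (hψ : IsBessel (quasiAffine A ψ))
    (hφ : IsBessel (quasiAffine B φ)) :
    AreOrthogonal (quasiAffine A ψ) (quasiAffine B φ) ↔ ∀ v,
      (∑' n : ℕ, levelOp A B ψ φ n v) + ∑' n : ℕ, levelOp A B ψ φ (-((n : ℤ) + 1)) v = 0 := by
  rw [areOrthogonal_iff_tsum hψ hφ]
  exact forall_congr' fun v => by rw [hψ.tsum_mixed_int hφ v]; rfl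

/-- Level zero is split off, and each later level n + 1 is D_B applied to level n. The term at level
zero is the defect in intertwining D_A with D_B. -/
theorem tsum_levelOp_dilation (hψ : IsBessel (quasiAffine A ψ)) (hφ : IsBessel (quasiAffine B φ))
    (v : L2 d) :
    ∑' n : ℕ, levelOp A B ψ φ n (dilationIsometry A v) =
      levelOp A B ψ φ 0 (dilationIsometry A v) +
        dilationIsometry B (∑' n : ℕ, levelOp A B ψ φ n v) := by
  have hs : ∀ v, Summable fun n : ℕ => levelOp A B ψ φ n v := fun v =>
    (summable_levelOp hψ hφ v).comp_injective Nat.cast_injective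
  rw [(hs _).tsum_eq_zero_add]
  simp only [levelOp_succ_dilation hψ hφ]
  congr 1
  exact ((dilationIsometry B).toLinearIsometry.toContinuousLinearMap.map_tsum (hs v)).symm

theorem IsIntegralMatrix.exists_intPt {M : Matrix (Fin d) (Fin d) ℝ} (hM : IsIntegralMatrix M)
    (a : Fin d → ℤ) : ∃ b : Fin d → ℤ, Matrix.toEuclideanLin M (intPt a) = intPt b := by
  choose N hN using hM
  refine ⟨fun i => ∑ j, N i j * a j, ?_⟩
  ext i
  simp [intPt, Matrix.toLpLin_apply, Matrix.mulVec, dotProduct, hN]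

theorem exists_intPt_ne {M N : Matrix (Fin d) (Fin d) ℝ} (h : M ≠ N) :
    ∃ a : Fin d → ℤ, Matrix.toEuclideanLin M (intPt a) ≠ Matrix.toEuclideanLin N (intPt a) := by
  contrapose! h
  ext i j
  have := congrArg (fun x : Eu d => x i) (h (Pi.single j 1))
  simpa [intPt, Matrix.toLpLin_apply, Matrix.mulVec, dotProduct, Pi.single_apply] using this

/-- Quasi-affine systems of different dilations are orthogonal only if their nonnegative levels
and their negative levels are orthogonal separately. -/
theorem areOrthogonal_quasiAffine_iff_levelOp
    (hAint : IsIntegralMatrix (A : Matrix (Fin d) (Fin d) ℝ)) (hAB : A ≠ B)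
    (hψ : IsBessel (quasiAffine A ψ)) (hφ : IsBessel (quasiAffine B φ)) :
    AreOrthogonal (quasiAffine A ψ) (quasiAffine B φ) ↔
      (∀ v, levelOp A B ψ φ 0 v = 0) ∧
        ∀ v, ∑' n : ℕ, levelOp A B ψ φ (-((n : ℤ) + 1)) v = 0 := by
  rw [areOrthogonal_quasiAffine_iff_tsum hψ hφ]
  constructor
  · intro h
    set R : L2 d → L2 d := fun v => ∑' n : ℕ, levelOp A B ψ φ n v with hR
    have hRQ : ∀ v, R v = -∑' n : ℕ, levelOp A B ψ φ (-((n : ℤ) + 1)) v := fun v =>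
      eq_neg_of_add_eq_zero_left (h v)
    -- The positive levels need not commute with integer translations; R inherits this from the
    -- negative levels through R = -Q.
    have hRT : ∀ (a : Fin d → ℤ) v, R (translationIsometry (intPt a) v) =
        translationIsometry (intPt a) (R v) := by
      intro a v
      have hs : Summable fun n : ℕ => levelOp A B ψ φ (-((n : ℤ) + 1)) v :=
        (summable_levelOp hψ hφ v).comp_injective
          (i := fun n : ℕ => -((n : ℤ) + 1)) fun a b hab => by simpa using hab
      rw [hRQ, hRQ, map_neg]
      congr 1
      refine Eq.trans ?_
        ((translationIsometry (intPt a)).toContinuousLinearMap.map_tsum hs).symm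
      exact tsum_congr fun n => levelOp_translation hψ hφ (by omega) a v
    have hRD : ∀ v, R (dilationIsometry A v) =
        levelOp A B ψ φ 0 (dilationIsometry A v) + dilationIsometry B (R v) :=
      tsum_levelOp_dilation hψ hφ
    have hR0 : ∀ v, R v = 0 := by
      intro v
      obtain ⟨a, ha⟩ := exists_intPt_ne (M := (A : Matrix (Fin d) (Fin d) ℝ))
        (N := (B : Matrix (Fin d) (Fin d) ℝ)) fun h => hAB (Units.ext h)
      obtain ⟨b, hb⟩ := hAint.exists_intPt a
      have hBinv : ∀ x, Matrix.toEuclideanLin (B : Matrix (Fin d) (Fin d) ℝ)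
          (Matrix.toEuclideanLin ((B⁻¹ : GL (Fin d) ℝ) : Matrix (Fin d) (Fin d) ℝ) x) = x :=
        toEuclideanLin_apply_apply_of_mul_eq_one (by
          rw [← Units.val_mul, mul_inv_cancel, Units.val_one])
      -- c = B⁻¹Aa is the translation that D_B makes out of b = Aa. It differs from a since Aa ≠ Ba,
      -- and it need not be an integer vector.
      set c := Matrix.toEuclideanLin ((B⁻¹ : GL (Fin d) ℝ) : Matrix (Fin d) (Fin d) ℝ) (intPt b)
        with hc
      have hac : intPt a ≠ c := by
        rintro hac
        rw [hb, hac, hBinv] at ha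
        exact ha rfl
      have hDA : dilationIsometry A (translationIsometry (intPt b) v) =
          translationIsometry (intPt a) (dilationIsometry A v) := by
        have := dilation_translation A (intPt a) v
        rw [hb] at this
        exact this
      have hDB : dilationIsometry B (translationIsometry (intPt b) (R v)) =
          translationIsometry c (dilationIsometry B (R v)) := by
        have := dilation_translation B c (R v)
        rw [hBinv] at this
        exact this
      have h1 := hRD (translationIsometry (intPt b) v)
      -- Both sides now contain T_a S_0 D_A v. Cancelling it leaves T_a D_B R v = T_c D_B R v.
      rw [hDA, hRT, hRT, hRD, levelOp_translation hψ hφ le_rfl, map_add, hDB] at h1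
      have h2 := eq_zero_of_translation_eq hac (add_left_cancel h1)
      exact (dilationIsometry B).map_eq_zero_iff.1 h2
    refine ⟨fun v => ?_, fun v => by simpa [hR0] using hRQ v⟩
    have h1 := hRD ((dilationIsometry A).symm v)
    rw [hR0, hR0, map_zero, add_zero, LinearIsometryEquiv.apply_symm_apply] at h1
    exact h1.symm
  · rintro ⟨h0, hneg⟩ v
    -- As D_A is surjective, S_{n+1} = D_B S_n D_A⁻¹, so vanishing spreads upwards from level zero.
    have hpos : ∀ (n : ℕ) (v : L2 d), levelOp A B ψ φ n v = 0 := by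
      intro n
      induction n with
      | zero => exact h0
      | succ n ih =>
        intro v
        rw [← (dilationIsometry A).apply_symm_apply v, levelOp_succ_dilation hψ hφ, ih, map_zero]
    rw [hneg, add_zero]
    simp only [hpos, tsum_zero]

end Operators

theorem fourier_negGenerators_ae (A : GL (Fin d) ℝ) (ψ : Fin r → L2 d) :
    ∀ᵐ ξ, ∀ p : ℕ × Fin r,
      (𝓕 (negGenerators A ψ p) : L2 d) ξ = (𝓕 (ψ p.2) : L2 d) (adjPow A (p.1 + 1) ξ) :=
  ae_all_iff.2 fun p => by
    have := fourier_renormDilation_zpow_ae A (p.1 + 1) (ψ p.2)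
    push_cast at this
    exact this

end

end QuasiAffine

end

/-! ### The characterization of orthogonality -/

open QuasiAffine
theorem theoremT {d r : ℕ} (A B : GL (Fin d) ℝ)
    (hA : IsExpansive (A : Matrix (Fin d) (Fin d) ℝ))
    (hAint : IsIntegralMatrix (A : Matrix (Fin d) (Fin d) ℝ))
    (hB : IsExpansive (B : Matrix (Fin d) (Fin d) ℝ))
    (hAB : A ≠ B)
    (ψ φ : Fin r → L2 d)
    (hψ : IsBessel (quasiAffine A ψ))
    (hφ : IsBessel (quasiAffine B φ)) :
    (∀ (k : Fin d → ℤ) (i : Fin r), ∀ᵐ ξ : Eu d,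
      Summable (fun j : ℕ => (starRingEnd ℂ) ((𝓕 (ψ i) : L2 d) (adjPow A (j + 1) ξ)) *
        (𝓕 (φ i) : L2 d) (adjPow B (j + 1) (ξ + intPt k)))) ∧
    (AreOrthogonal (quasiAffine A ψ) (quasiAffine B φ) ↔
      (∀ k : Fin d → ℤ, ∀ᵐ ξ : Eu d,
        ∑ i, (starRingEnd ℂ) ((𝓕 (ψ i) : L2 d) ξ) * (𝓕 (φ i) : L2 d) (ξ + intPt k) = 0) ∧
      (∀ k : Fin d → ℤ, ∀ᵐ ξ : Eu d,
        ∑ i, ∑' j : ℕ, (starRingEnd ℂ) ((𝓕 (ψ i) : L2 d) (adjPow A (j + 1) ξ)) *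
          (𝓕 (φ i) : L2 d) (adjPow B (j + 1) (ξ + intPt k)) = 0)) := by
  have hψ' := hψ.shiftSystem_negGenerators
  have hφ' := hφ.shiftSystem_negGenerators
  have hsum : ∀ k : Fin d → ℤ, ∀ᵐ ξ : Eu d, Summable fun p : ℕ × Fin r =>
      (starRingEnd ℂ) ((𝓕 (ψ p.2) : L2 d) (adjPow A (p.1 + 1) ξ)) *
        (𝓕 (φ p.2) : L2 d) (adjPow B (p.1 + 1) (ξ + intPt k)) := by
    intro k
    filter_upwards [hψ'.ae_summable_fourier hφ' k, fourier_negGenerators_ae A ψ,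
      ae_add_intPt (fourier_negGenerators_ae B φ) k] with ξ h h1 h2
    simpa only [h1, h2] using h
  refine ⟨fun k i => ?_, ?_⟩
  · filter_upwards [hsum k] with ξ h
    exact h.comp_injective (i := fun j : ℕ => (j, i)) fun _ _ h => (Prod.mk.inj h).1
  rw [areOrthogonal_quasiAffine_iff_levelOp hAint hAB hψ hφ, levelOp_zero_iff hψ hφ,
    tsum_levelOp_neg_iff hψ hφ, areOrthogonal_shiftSystem_iff hψ' hφ',
    areOrthogonal_shiftSystem_iff hψ.shiftSystem_generators hφ.shiftSystem_generators]
  refine and_congr ?_ ?_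
  · simp only [tsum_fintype]
  · refine forall_congr' fun k => Filter.eventually_congr ?_
    filter_upwards [hsum k, fourier_negGenerators_ae A ψ,
      ae_add_intPt (fourier_negGenerators_ae B φ) k] with ξ h h1 h2
    simp only [h1, h2]
    -- Summability over all pairs (j, i) permits rewriting the correlation as the iterated sum with
    -- i outside.
    have h' := (Equiv.prodComm (Fin r) ℕ).summable_iff.2 h
    rw [← (Equiv.prodComm (Fin r) ℕ).tsum_eq, ← tsum_fintype (L := .unconditional _)]
    exact iff_of_eq (congrArg (· = 0) h'.tsum_prod)
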